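/- For a function $f:\mathbb{R}^2\to\mathbb{C}$ let $$E^{S_6}f(x)=\int_{[-1,1]^2} f(\xi)\,e^{2\pi i(\xi_1x_1+\xi_2x_2+\xi_1^2x_3+\xi_1\xi_2x_4)}\,d\xi,\qquad x\in\mathbb{R}^4,$$ be the Fourier extension operator associated with the surface $S_6=\{(\xi_1,\xi_2,\xi_1^2,\xi_1\xi_2):\xi\in[-1,1]^2\}$ in $\mathbb{R}^4$. Let $p_1,q_1\in(0,\infty]$, with the convention $1/\infty=0$, and consider the estimate $$\|E^{S_6}f\|_{L^{q_1}(\mathbb{R}^4)}\le C_{p_1,q_1}\|f\|_{L^{p_1}(\mathbb{R}^2)}\qquad\text{for all } f\in L^{p_1}(\mathbb{R}^2),\tag{$*$}$$ with a finite constant $C_{p_1,q_1}$ that depends only on $p_1$ and $q_1$. (If $p_1<1$, only those $f$ that are integrable on $[-1,1]^2$ are considered in $(*)$.) (i) If $q_1>5$ and $\frac1{p_1}+\frac4{q_1}<1$, then $(*)$ holds. (ii) This range is sharp up to endpoints: if $q_1<5$ or $\frac1{p_1}+\frac4{q_1}>1$, then $(*)$ fails for every finite constant. -/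

import Mathlib

open MeasureTheory

open scoped NNReal ENNReal

/-- The phase `x · (ξ₁, ξ₂, ξ₁², ξ₁ ξ₂)` of the surface `S₆ = {(ξ₁, ξ₂, ξ₁², ξ₁ ξ₂)}` in `ℝ⁴`. -/
def phaseS6 (x : Fin 4 → ℝ) (ξ : Fin 2 → ℝ) : ℝ :=
  ξ 0 * x 0 + ξ 1 * x 1 + ξ 0 ^ 2 * x 2 + ξ 0 * ξ 1 * x 3

/-- The Fourier extension operator of `S₆` over the square `[-1, 1]²`:
`E f (x) = ∫_{[-1,1]²} f(ξ) e(x · (ξ₁, ξ₂, ξ₁², ξ₁ ξ₂)) dξ`, where `e(t) = exp(2 π i t)`. -/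
noncomputable def extS6 (f : (Fin 2 → ℝ) → ℂ) (x : Fin 4 → ℝ) : ℂ :=
  ∫ ξ in Set.Icc (-1 : Fin 2 → ℝ) 1,
    f ξ * Complex.exp (2 * Real.pi * Complex.I * (phaseS6 x ξ : ℂ))

/-- The extension estimate `‖E f‖_{L^q(ℝ⁴)} ≤ C ‖f‖_{L^p(ℝ²)}` for all `f ∈ L^p(ℝ²)`, with a finite
constant `C` that may depend on `p` and `q` only. For `p ≥ 1` every `f ∈ L^p` is integrable on the
square. For `p < 1` a function that is not integrable there has `extS6 f = 0`, so it satisfies the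
inequality and cannot be the reason for a failure of the estimate. -/
def ExtensionEstimateS6 (p q : ℝ≥0∞) : Prop :=
  ∃ C : ℝ≥0, ∀ f : (Fin 2 → ℝ) → ℂ, MemLp f p volume →
    eLpNorm (extS6 f) q volume ≤ (C : ℝ≥0∞) * eLpNorm f p volume

/-! Write x = (a, b, c, d) and ξ = (s, w). The phase is s a + s² c + w (b + s d). Integrating in w
first therefore shows that, for fixed (b, d), E f is the parabola extension in (a, c) of g(s) =
F_s(b + s d), where F_s is the Fourier transform of f(s, ·) cut off to [-1, 1].

Positive range. Let q = 5 + 2ε. Squaring the parabola extension, a weighted Hausdorff–Young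
inequality and fractional integration bound its q-th power integral by ∬ |g(s)|^(q/2) |g(t)|^(q/2)
|s - t|^(ε/4) (`exists_lintegral_parabola_rpow_le`). Integrating over (b, d), the linear map (b, d)
↦ (b + s d, b + t d) decouples the two factors at the cost of |s - t|⁻¹ (`lintegral_lines`). The
surviving weight |s - t|^(ε/4 - 1) is integrable, and this margin disappears at q = 5. Plancherel in
w then gives ∫ |E f|^q ≤ C ‖f‖₁ whenever |f| ≤ 1 (`exists_lintegral_extS6_rpow_le`). Combining this
with the trivial bound |E f| ≤ ‖f‖₁ and summing over dyadic level sets of f gives the open range for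
finite exponents. Infinite exponents follow from the trivial bound and monotonicity in p on the
square.

Sharpness. The indicator of [0, δ] × [0, 1] has |E f| ≳ δ on a dual box of volume ~ δ⁻⁴, which
forces 1/p + 4/q ≤ 1. For the tent function in w, every F_s is the Fejér kernel, so g lives near s =
-b/d at scale 1/d. For d ~ R this gives |E f| ≳ 1/R on a set of measure ~ R⁵ (`le_norm_extS6_tent`),
which forces q ≥ 5. -/

/-! ### The additive character -/

/-- The additive character `t ↦ exp(2πit)`. -/
noncomputable def chi (t : ℝ) : ℂ := Complex.exp (2 * Real.pi * Complex.I * (t : ℂ))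

theorem chi_eq_exp_ofReal_mul_I (t : ℝ) : chi t = Complex.exp ((2 * Real.pi * t : ℝ) * Complex.I) := by
  unfold chi; congr 1; push_cast; ring

@[simp] theorem norm_chi (t : ℝ) : ‖chi t‖ = 1 := by
  rw [chi_eq_exp_ofReal_mul_I, Complex.norm_exp_ofReal_mul_I]

@[simp] theorem enorm_chi (t : ℝ) : ‖chi t‖ₑ = 1 := by
  rw [← ofReal_norm, norm_chi, ENNReal.ofReal_one]

theorem chi_add (s t : ℝ) : chi (s + t) = chi s * chi t := by
  unfold chi; rw [← Complex.exp_add]; congr 1; push_cast; ring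

theorem conj_chi (t : ℝ) : (starRingEnd ℂ) (chi t) = chi (-t) := by
  rw [chi_eq_exp_ofReal_mul_I, chi_eq_exp_ofReal_mul_I, ← Complex.exp_conj, map_mul,
    Complex.conj_ofReal, Complex.conj_I]
  congr 1; push_cast; ring

theorem re_chi (t : ℝ) : (chi t).re = Real.cos (2 * Real.pi * t) := by
  rw [chi_eq_exp_ofReal_mul_I, Complex.exp_ofReal_mul_I_re]

@[fun_prop] theorem continuous_chi : Continuous chi := by unfold chi; fun_prop

@[fun_prop] theorem measurable_chi : Measurable chi := continuous_chi.measurable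

theorem integrable_mul_chi {α : Type*} [MeasurableSpace α] {μ : Measure α} {g : α → ℂ}
    (hg : Integrable g μ) {φ : α → ℝ} (hφ : Measurable φ) :
    Integrable (fun a => g a * chi (φ a)) μ := by
  refine hg.mul_bdd (c := 1) (by fun_prop) (Filter.Eventually.of_forall fun a => by simp)

/-! ### Plancherel on the line for integrable functions -/

section Plancherel

open FourierTransform SchwartzMap

theorem integral_mul_chi_eq_fourier (g : ℝ → ℂ) (y : ℝ) :
    ∫ w, g w * chi (w * y) = 𝓕 g (-y) := by
  rw [Real.fourier_real_eq_integral_exp_smul]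
  congr 1; ext w
  rw [smul_eq_mul, mul_comm, chi]
  congr 2; push_cast; ring

/-- Both transforms move onto a test function by duality: the L² one as a tempered distribution, the
integral one by Fubini. They therefore agree against every smooth compactly supported function. -/
theorem fourier_toLp_ae_eq {g : ℝ → ℂ} (hg : Integrable g) (hg2 : MemLp g 2) :
    (𝓕 (hg2.toLp g) : Lp (α := ℝ) ℂ 2 volume) =ᵐ[volume] 𝓕 g := by
  have hcont : Continuous (𝓕 g) :=
    VectorFourier.fourierIntegral_continuous Real.continuous_fourierChar (by exact continuous_inner) hg
  refine ae_eq_of_integral_contDiff_smul_eq ((Lp.memLp _).locallyIntegrable (by norm_num))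
    hcont.locallyIntegrable ?_
  intro φ hφ hφc
  have h₁ : HasCompactSupport (Complex.ofRealCLM ∘ φ) := hφc.comp_left rfl
  have h₂ : ContDiff ℝ (⊤ : ℕ∞) (Complex.ofRealCLM ∘ φ) := by fun_prop
  set ψ : 𝓢(ℝ, ℂ) := h₁.toSchwartzMap h₂
  have e1 := congrArg (fun T : 𝓢'(ℝ, ℂ) => T ψ) (Lp.fourier_toTemperedDistribution_eq (hg2.toLp g))
  simp only [TemperedDistribution.fourier_apply, Lp.toTemperedDistribution_apply] at e1
  have e2 : ∫ x, (𝓕 ψ) x • (hg2.toLp g) x = ∫ x, (𝓕 ψ) x • g x := by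
    refine integral_congr_ae ?_
    filter_upwards [hg2.coeFn_toLp] with x hx
    rw [hx]
  have e3 : ∫ x, (𝓕 (ψ : ℝ → ℂ)) x • g x = ∫ x, ψ x • (𝓕 g) x := by
    have := VectorFourier.integral_fourierIntegral_smul_eq_flip (μ := volume) (ν := volume)
      (L := innerₗ ℝ) (e := Real.fourierChar) (f := ψ) (g := g)
      Real.continuous_fourierChar (by exact continuous_inner) (SchwartzMap.integrable ψ) hg
    rw [flip_innerₗ] at this
    exact this
  rw [e2] at e1
  have e4 : ∫ x, φ x • (𝓕 (hg2.toLp g) : Lp (α := ℝ) ℂ 2 volume) x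
      = ∫ x, ψ x • (𝓕 (hg2.toLp g) : Lp (α := ℝ) ℂ 2 volume) x := by
    congr 1
  have e5 : ∫ x, φ x • (𝓕 g) x = ∫ x, ψ x • (𝓕 g) x := by
    congr 1
  rw [e4, e5, ← e1, ← e3]
  rfl

/-- Plancherel's inequality for integrable functions, with possibly infinite right-hand side. -/
theorem lintegral_enorm_integral_mul_chi_sq_le {g : ℝ → ℂ} (hg : Integrable g) :
    ∫⁻ y, ‖∫ w, g w * chi (w * y)‖ₑ ^ (2 : ℝ) ≤ ∫⁻ w, ‖g w‖ₑ ^ (2 : ℝ) := by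
  by_cases htop : ∫⁻ w, ‖g w‖ₑ ^ (2 : ℝ) = ∞
  · rw [htop]; exact le_top
  have hg2 : MemLp g 2 := by
    refine ⟨hg.1, ?_⟩
    rw [eLpNorm_lt_top_iff_lintegral_rpow_enorm_lt_top (by norm_num) (by norm_num)]
    simpa using lt_top_iff_ne_top.2 htop
  simp_rw [integral_mul_chi_eq_fourier]
  rw [lintegral_neg_eq_self (fun y => ‖𝓕 g y‖ₑ ^ (2 : ℝ))]
  have h := Lp.norm_fourier_eq (hg2.toLp g)
  rw [Lp.norm_def, Lp.norm_def, ENNReal.toReal_eq_toReal_iff' (Lp.eLpNorm_ne_top _)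
    (Lp.eLpNorm_ne_top _), eLpNorm_congr_ae (fourier_toLp_ae_eq hg hg2),
    eLpNorm_congr_ae hg2.coeFn_toLp, eLpNorm_eq_lintegral_rpow_enorm_toReal (by norm_num) (by norm_num),
    eLpNorm_eq_lintegral_rpow_enorm_toReal (by norm_num) (by norm_num)] at h
  have := (ENNReal.rpow_left_injective (x := 1 / 2) (by norm_num)) (by simpa using h)
  simpa using this.le

end Plancherel

/-! ### Weighted Hausdorff–Young by real interpolation -/

theorem lintegral_Ioc_zero_rpow {r : ℝ} (hr : -1 < r) {L : ℝ} (hL : 0 ≤ L) :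
    ∫⁻ x in Set.Ioc 0 L, ENNReal.ofReal (x ^ r) = ENNReal.ofReal (L ^ (r + 1) / (r + 1)) := by
  rw [← ofReal_integral_eq_lintegral_ofReal]
  · rw [← intervalIntegral.integral_of_le hL, integral_rpow (Or.inl hr),
      Real.zero_rpow (by linarith), sub_zero]
  · rw [← IntegrableOn, ← intervalIntegrable_iff_integrableOn_Ioc_of_le hL]
    exact intervalIntegral.intervalIntegrable_rpow' hr
  · filter_upwards [ae_restrict_mem measurableSet_Ioc] with x hx
    exact Real.rpow_nonneg hx.1.le r

/-- Where `f` exceeds t, `g` is at least t/2, and Chebyshev in L² applies to `g`. Here `f - g` will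
be the image of the part of the input that is small in L¹. -/
theorem meas_lt_norm_le_of_enorm_sub_le {Y : Type*} [MeasurableSpace Y] {ν : Measure Y}
    {f g : Y → ℂ} (hg : Measurable g) {t : ℝ} (ht : 0 < t)
    (hfg : ∀ y, ‖f y - g y‖ₑ ≤ ENNReal.ofReal t / 2) :
    ν {y | t < ‖f y‖} ≤ 4 * ENNReal.ofReal (t ^ (-2 : ℝ)) * ∫⁻ y, ‖g y‖ₑ ^ (2 : ℝ) ∂ν := by
  have hsub : {y | t < ‖f y‖} ⊆ {y | ENNReal.ofReal (t ^ 2 / 4) ≤ ‖g y‖ₑ ^ (2 : ℝ)} := by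
    intro y hy
    have h1 : ‖f y - g y‖ ≤ t / 2 := by
      have := hfg y
      rw [← ofReal_norm, show (2 : ℝ≥0∞) = ENNReal.ofReal 2 by simp,
        ← ENNReal.ofReal_div_of_pos (by norm_num)] at this
      exact (ENNReal.ofReal_le_ofReal_iff (by positivity)).1 this
    have h2 : ‖f y‖ ≤ ‖f y - g y‖ + ‖g y‖ := by simpa using norm_add_le (f y - g y) (g y)
    have h3 : t / 2 ≤ ‖g y‖ := by
      have : t < ‖f y‖ := hy
      linarith
    have : t ^ 2 / 4 ≤ ‖g y‖ ^ (2 : ℝ) := by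
      rw [Real.rpow_two]; nlinarith
    simp only [Set.mem_ofPred_eq]
    rw [← ofReal_norm, ENNReal.ofReal_rpow_of_nonneg (norm_nonneg _) (by norm_num)]
    exact ENNReal.ofReal_le_ofReal this
  have hmeas : Measurable fun y => ‖g y‖ₑ ^ (2 : ℝ) := by fun_prop
  have hc := mul_meas_ge_le_lintegral (μ := ν) hmeas (ENNReal.ofReal (t ^ 2 / 4))
  have hone : 4 * ENNReal.ofReal (t ^ (-2 : ℝ)) * ENNReal.ofReal (t ^ 2 / 4) = 1 := by
    rw [show (4 : ℝ≥0∞) = ENNReal.ofReal 4 by simp, ← ENNReal.ofReal_mul (by norm_num),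
      ← ENNReal.ofReal_mul (by positivity), Real.rpow_neg ht.le, Real.rpow_two,
      ← ENNReal.ofReal_one]
    congr 1; field_simp
  calc ν {y | t < ‖f y‖} ≤ ν {y | ENNReal.ofReal (t ^ 2 / 4) ≤ ‖g y‖ₑ ^ (2 : ℝ)} := measure_mono hsub
    _ = 4 * ENNReal.ofReal (t ^ (-2 : ℝ)) * (ENNReal.ofReal (t ^ 2 / 4) *
        ν {y | ENNReal.ofReal (t ^ 2 / 4) ≤ ‖g y‖ₑ ^ (2 : ℝ)}) := by rw [← mul_assoc, hone, one_mul]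
    _ ≤ _ := by gcongr

/-- The inner integral in the layer-cake computation of the interpolation argument. -/
theorem sq_mul_weight_mul_lintegral_le {τ ρ : ℝ} (hτ : 2 < τ) (hρ : ρ = τ / (τ - 1)) {x v N : ℝ≥0∞}
    (hx : x ≠ ∞) (hv : v ≠ ∞) (hN : N ≠ ∞) :
    (x ^ (2 : ℝ) * v) * ∫⁻ t in Set.Ioi (0 : ℝ),
        {t : ℝ | ENNReal.ofReal t * (x * v) ^ (ρ - 1) ≤ 2 * N}.indicator
          (fun t => ENNReal.ofReal (t ^ (τ - 3))) t
      ≤ ENNReal.ofReal (2 ^ (τ - 2) / (τ - 2)) * N ^ (τ - 2) * (x ^ ρ * v ^ (ρ - 1)) := by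
  have hρ1 : 0 < ρ - 1 := by
    rw [hρ, sub_pos, lt_div_iff₀ (by linarith)]; linarith
  by_cases h0 : x ^ (2 : ℝ) * v = 0
  · rw [h0, zero_mul]; exact zero_le
  have hx0 : x ≠ 0 := by rintro rfl; simp at h0
  have hv0 : v ≠ 0 := by rintro rfl; simp at h0
  lift x to ℝ≥0 using hx
  lift v to ℝ≥0 using hv
  lift N to ℝ≥0 using hN
  have hxp : (0 : ℝ) < x := by
    have : x ≠ 0 := by simpa using hx0
    positivity
  have hvp : (0 : ℝ) < v := by
    have : v ≠ 0 := by simpa using hv0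
    positivity
  set A : ℝ := (x * v : ℝ) ^ (ρ - 1) with hA
  have hAp : 0 < A := by positivity
  set L : ℝ := 2 * N / A with hL
  have hAe : ((x : ℝ≥0∞) * v) ^ (ρ - 1) = ENNReal.ofReal A := by
    rw [hA, ← ENNReal.ofReal_rpow_of_pos (by positivity), ENNReal.ofReal_mul (by positivity)]
    simp
  have hset : Set.Ioi (0 : ℝ) ∩ {t : ℝ | ENNReal.ofReal t * ((x : ℝ≥0∞) * v) ^ (ρ - 1) ≤ 2 * N}
      ⊆ Set.Ioc 0 L := by
    rintro t ⟨ht, ht2⟩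
    refine ⟨ht, ?_⟩
    simp only [Set.mem_ofPred_eq] at ht2
    rw [hAe, ← ENNReal.ofReal_mul (le_of_lt ht), show (2 : ℝ≥0∞) * N = ENNReal.ofReal (2 * N) by
      rw [ENNReal.ofReal_mul (by norm_num)]; simp,
      ENNReal.ofReal_le_ofReal_iff (by positivity)] at ht2
    rw [hL, le_div_iff₀ hAp]; exact ht2
  have hms : MeasurableSet {t : ℝ | ENNReal.ofReal t * ((x : ℝ≥0∞) * v) ^ (ρ - 1) ≤ 2 * N} :=
    measurableSet_le (by fun_prop) (by fun_prop)
  calc _ = ((x : ℝ≥0∞) ^ (2 : ℝ) * v) * ∫⁻ t in Set.Ioi (0 : ℝ) ∩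
        {t : ℝ | ENNReal.ofReal t * ((x : ℝ≥0∞) * v) ^ (ρ - 1) ≤ 2 * N},
          ENNReal.ofReal (t ^ (τ - 3)) := by
        rw [lintegral_indicator hms, Measure.restrict_restrict hms, Set.inter_comm]
    _ ≤ ((x : ℝ≥0∞) ^ (2 : ℝ) * v) * ∫⁻ t in Set.Ioc 0 L, ENNReal.ofReal (t ^ (τ - 3)) := by
        gcongr
    _ = ENNReal.ofReal ((x : ℝ) ^ (2 : ℝ) * v * (L ^ (τ - 3 + 1) / (τ - 3 + 1))) := by
        rw [lintegral_Ioc_zero_rpow (by linarith) (by positivity), ENNReal.ofReal_mul (by positivity),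
          ENNReal.ofReal_mul (by positivity), ← ENNReal.ofReal_rpow_of_pos hxp]
        simp
    _ = ENNReal.ofReal (2 ^ (τ - 2) / (τ - 2) * (N : ℝ) ^ (τ - 2) * ((x : ℝ) ^ ρ * (v : ℝ) ^ (ρ - 1))) := by
        congr 1
        have e1 : τ - 3 + 1 = τ - 2 := by ring
        -- This identity turns x² v (x v)^(-(ρ-1)(τ-2)) into x^ρ v^(ρ-1).
        have e2 : (ρ - 1) * (τ - 2) = 2 - ρ := by
          have : τ - 1 ≠ 0 := by linarith
          rw [hρ]; field_simp; ring
        rw [e1, hL, Real.div_rpow (by positivity) hAp.le, Real.mul_rpow (by norm_num) (by positivity), hA,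
          ← Real.rpow_mul (by positivity), e2, Real.mul_rpow hxp.le hvp.le,
          Real.rpow_sub hxp, Real.rpow_sub hvp, Real.rpow_sub hvp, Real.rpow_one, Real.rpow_two,
          Real.rpow_two]
        have : τ - 2 ≠ 0 := by linarith
        field_simp
    _ = _ := by
        rw [ENNReal.ofReal_mul (by have : 0 < τ - 2 := by linarith
                                   positivity),
          ENNReal.ofReal_mul (by have : 0 < τ - 2 := by linarith
                                 positivity),
          ENNReal.ofReal_mul (by positivity), ← ENNReal.ofReal_rpow_of_nonneg (by positivity) (by linarith),
          ← ENNReal.ofReal_rpow_of_pos hxp, ← ENNReal.ofReal_rpow_of_pos hvp]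
        simp

/-- A weighted Hausdorff–Young inequality, by real interpolation between `L¹ → L^∞` and `L² → L²`:
if the operator `k ↦ ∫ k e` has a kernel bounded by one and satisfies a weighted `L²` estimate with
weight `V`, then it maps the weighted `L^ρ` space to `L^τ`, `1 / ρ + 1 / τ = 1`. -/
theorem lintegral_enorm_integral_rpow_le {Ω Y : Type*} [MeasurableSpace Ω] [MeasurableSpace Y]
    {μ : Measure Ω} {ν : Measure Y} [SFinite μ] [SFinite ν] {e : Y → Ω → ℂ}
    (he : Measurable (Function.uncurry e)) (he1 : ∀ y ω, ‖e y ω‖ ≤ 1) {V : Ω → ℝ≥0}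
    (hV : Measurable V)
    (h2 : ∀ k : Ω → ℂ, Measurable k → Integrable k μ →
      ∫⁻ y, ‖∫ ω, k ω * e y ω ∂μ‖ₑ ^ (2 : ℝ) ∂ν ≤ ∫⁻ ω, ‖k ω‖ₑ ^ (2 : ℝ) * V ω ∂μ)
    {τ ρ : ℝ} (hτ : 2 < τ) (hρ : ρ = τ / (τ - 1)) {k : Ω → ℂ} (hk : Measurable k)
    (hki : Integrable k μ) :
    ∫⁻ y, ‖∫ ω, k ω * e y ω ∂μ‖ₑ ^ τ ∂ν ≤
      ENNReal.ofReal (4 * τ * (2 ^ (τ - 2) / (τ - 2))) *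
        (∫⁻ ω, ‖k ω‖ₑ ^ ρ * (V ω : ℝ≥0∞) ^ (ρ - 1) ∂μ) ^ (τ - 1) := by
  have hρ1 : 0 < ρ - 1 := by
    rw [hρ, sub_pos, lt_div_iff₀ (by linarith)]; linarith
  have hey : ∀ y, Measurable (e y) := fun y => he.comp measurable_prodMk_left
  have hmT : ∀ k' : Ω → ℂ, Measurable k' → Measurable fun y => ∫ ω, k' ω * e y ω ∂μ := by
    intro k' hk'
    refine (StronglyMeasurable.integral_prod_right ?_).measurable
    exact ((hk'.comp measurable_snd).mul he).stronglyMeasurable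
  have hintegrable : ∀ k' : Ω → ℂ, Integrable k' μ → ∀ y, Integrable (fun ω => k' ω * e y ω) μ := by
    intro k' hk' y
    exact hk'.mul_bdd (c := 1) (hey y).aestronglyMeasurable (Filter.Eventually.of_forall (he1 y))
  set N := ∫⁻ ω, ‖k ω‖ₑ ^ ρ * (V ω : ℝ≥0∞) ^ (ρ - 1) ∂μ with hN
  have hCpos : 0 < 4 * τ * (2 ^ (τ - 2) / (τ - 2)) := by
    have : 0 < τ - 2 := by linarith
    positivity
  by_cases hNtop : N = ∞
  · rw [hNtop, ENNReal.top_rpow_of_pos (by linarith), ENNReal.mul_top (by simpa using hCpos)]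
    exact le_top
  -- A factor N is cancelled below, so N = 0 is treated apart: the weighted L² integral of `k` then
  -- vanishes as well.
  by_cases hN0 : N = 0
  · have h3 : ∀ᵐ ω ∂μ, ‖k ω‖ₑ ^ ρ * (V ω : ℝ≥0∞) ^ (ρ - 1) = 0 :=
      (lintegral_eq_zero_iff (by fun_prop)).1 (hN ▸ hN0)
    have h4 : ∫⁻ ω, ‖k ω‖ₑ ^ (2 : ℝ) * V ω ∂μ = 0 := by
      rw [lintegral_eq_zero_iff (by fun_prop)]
      filter_upwards [h3] with ω hω
      rcases mul_eq_zero.1 hω with h | h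
      · have : ‖k ω‖ₑ = 0 := by
          rcases ENNReal.rpow_eq_zero_iff.1 h with h | h
          · exact h.1
          · exact absurd h.1 (by simp)
        simp only [this, Pi.zero_apply]
        simp
      · have : (V ω : ℝ≥0∞) = 0 := by
          rcases ENNReal.rpow_eq_zero_iff.1 h with h | h
          · exact h.1
          · exact absurd h.1 (by simp)
        simp [this]
    have h5 := h2 k hk hki
    rw [h4, nonpos_iff_eq_zero, lintegral_eq_zero_iff (by have := hmT k hk; fun_prop)] at h5
    have h6 : ∫⁻ y, ‖∫ ω, k ω * e y ω ∂μ‖ₑ ^ τ ∂ν = 0 := by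
      rw [lintegral_eq_zero_iff (by have := hmT k hk; fun_prop)]
      filter_upwards [h5] with y hy
      have : ‖∫ ω, k ω * e y ω ∂μ‖ₑ = 0 := by simpa using hy
      simp only [this, Pi.zero_apply]
      exact ENNReal.zero_rpow_of_pos (by linarith)
    rw [h6]; exact zero_le
  -- Truncation at height t. Off `S t` one has 2N|k| ≤ t |k|^ρ V^(ρ-1), so that part of `k` has L¹
  -- norm at most t/2 and its image is at most t/2 everywhere. The part on `S t` is handled by the
  -- L² hypothesis.
  set S : ℝ → Set Ω := fun t => {ω | ENNReal.ofReal t * (‖k ω‖ₑ * V ω) ^ (ρ - 1) ≤ 2 * N} with hS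
  have hSm : ∀ t, MeasurableSet (S t) := fun t => measurableSet_le (by fun_prop) (by fun_prop)
  have hlarge : ∀ t, 0 < t → ∫⁻ ω in (S t)ᶜ, ‖k ω‖ₑ ∂μ ≤ ENNReal.ofReal t / 2 := by
    intro t ht
    have h1 : (2 * N) * ∫⁻ ω in (S t)ᶜ, ‖k ω‖ₑ ∂μ ≤ ENNReal.ofReal t * N := by
      rw [← lintegral_const_mul _ (by fun_prop)]
      calc ∫⁻ ω in (S t)ᶜ, 2 * N * ‖k ω‖ₑ ∂μ
          ≤ ∫⁻ ω in (S t)ᶜ, ENNReal.ofReal t * (‖k ω‖ₑ ^ ρ * (V ω : ℝ≥0∞) ^ (ρ - 1)) ∂μ := by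
            refine setLIntegral_mono (by fun_prop) fun ω hω => ?_
            have hω' : 2 * N < ENNReal.ofReal t * (‖k ω‖ₑ * V ω) ^ (ρ - 1) := by
              simpa [S] using hω
            calc 2 * N * ‖k ω‖ₑ ≤ ENNReal.ofReal t * (‖k ω‖ₑ * V ω) ^ (ρ - 1) * ‖k ω‖ₑ := by
                  gcongr
              _ = ENNReal.ofReal t * ((‖k ω‖ₑ ^ (ρ - 1) * ‖k ω‖ₑ ^ (1 : ℝ)) *
                    (V ω : ℝ≥0∞) ^ (ρ - 1)) := by
                  rw [ENNReal.mul_rpow_of_nonneg _ _ hρ1.le, ENNReal.rpow_one]; ring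
              _ = _ := by
                  rw [← ENNReal.rpow_add_of_nonneg _ _ hρ1.le zero_le_one, sub_add_cancel]
        _ ≤ ∫⁻ ω, ENNReal.ofReal t * (‖k ω‖ₑ ^ ρ * (V ω : ℝ≥0∞) ^ (ρ - 1)) ∂μ :=
            setLIntegral_le_lintegral _ _
        _ = ENNReal.ofReal t * N := lintegral_const_mul _ (by fun_prop)
    rw [ENNReal.le_div_iff_mul_le (by simp) (by simp)]
    refine (ENNReal.mul_le_mul_iff_left hN0 hNtop).1 ?_
    calc _ = (2 * N) * ∫⁻ ω in (S t)ᶜ, ‖k ω‖ₑ ∂μ := by ring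
      _ ≤ _ := h1
  have hmeas : ∀ t, 0 < t → ν {y | t < ‖∫ ω, k ω * e y ω ∂μ‖} ≤
      4 * ENNReal.ofReal (t ^ (-2 : ℝ)) * ∫⁻ ω in S t, ‖k ω‖ₑ ^ (2 : ℝ) * V ω ∂μ := by
    intro t ht
    have hks : Integrable ((S t).indicator k) μ := hki.indicator (hSm t)
    have hksm : Measurable ((S t).indicator k) := hk.indicator (hSm t)
    refine (meas_lt_norm_le_of_enorm_sub_le (hmT _ hksm) ht fun y => ?_).trans ?_
    · rw [← integral_sub (hintegrable k hki y) (hintegrable _ hks y)]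
      refine (enorm_integral_le_lintegral_enorm _).trans (le_trans ?_ (hlarge t ht))
      rw [← lintegral_indicator (hSm t).compl]
      refine lintegral_mono fun ω => ?_
      by_cases hω : ω ∈ S t
      · simp [hω]
      · simp only [hω, not_false_eq_true, Set.indicator_of_notMem, zero_mul, sub_zero, Set.mem_compl_iff,
          Set.indicator_of_mem, enorm_mul]
        have : ‖e y ω‖ₑ ≤ 1 := by
          rw [← ofReal_norm]; exact ENNReal.ofReal_le_one.2 (he1 y ω)
        calc ‖k ω‖ₑ * ‖e y ω‖ₑ ≤ ‖k ω‖ₑ * 1 := by gcongr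
          _ = _ := mul_one _
    · gcongr
      refine (h2 _ hksm hks).trans (le_of_eq ?_)
      rw [← lintegral_indicator (hSm t)]
      congr 1; ext ω
      by_cases hω : ω ∈ S t <;> simp [hω]
  calc ∫⁻ y, ‖∫ ω, k ω * e y ω ∂μ‖ₑ ^ τ ∂ν
      = ∫⁻ y, ENNReal.ofReal (‖∫ ω, k ω * e y ω ∂μ‖ ^ τ) ∂ν := by
        congr 1; ext y
        rw [← ofReal_norm, ENNReal.ofReal_rpow_of_nonneg (norm_nonneg _) (by linarith)]
    _ = ENNReal.ofReal τ * ∫⁻ t in Set.Ioi 0, ν {y | t < ‖∫ ω, k ω * e y ω ∂μ‖} *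
          ENNReal.ofReal (t ^ (τ - 1)) :=
        lintegral_rpow_eq_lintegral_meas_lt_mul ν (Filter.Eventually.of_forall fun y => norm_nonneg _)
          (hmT k hk).norm.aemeasurable (by linarith)
    _ ≤ ENNReal.ofReal τ * ∫⁻ t in Set.Ioi 0, ∫⁻ ω, 4 * ((‖k ω‖ₑ ^ (2 : ℝ) * V ω) *
          {t : ℝ | ENNReal.ofReal t * (‖k ω‖ₑ * V ω) ^ (ρ - 1) ≤ 2 * N}.indicator
          (fun t => ENNReal.ofReal (t ^ (τ - 3))) t) ∂μ := by
        gcongr ENNReal.ofReal τ * ?_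
        refine setLIntegral_mono' measurableSet_Ioi fun t ht => ?_
        calc _ ≤ (4 * ENNReal.ofReal (t ^ (-2 : ℝ)) * ∫⁻ ω in S t, ‖k ω‖ₑ ^ (2 : ℝ) * V ω ∂μ) *
              ENNReal.ofReal (t ^ (τ - 1)) := by gcongr; exact hmeas t ht
          _ = 4 * ENNReal.ofReal (t ^ (τ - 3)) * ∫⁻ ω in S t, ‖k ω‖ₑ ^ (2 : ℝ) * V ω ∂μ := by
            have : ENNReal.ofReal (t ^ (τ - 3)) =
                ENNReal.ofReal (t ^ (-2 : ℝ)) * ENNReal.ofReal (t ^ (τ - 1)) := by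
              rw [← ENNReal.ofReal_mul (Real.rpow_nonneg (le_of_lt ht) _), ← Real.rpow_add ht]
              congr 2; ring
            rw [this]; ring
          _ = _ := by
            rw [← lintegral_indicator (hSm t), ← lintegral_const_mul _
              (Measurable.indicator (by fun_prop) (hSm t))]
            congr 1; ext ω
            by_cases hω : ω ∈ S t
            · have hω' : ENNReal.ofReal t * (‖k ω‖ₑ * V ω) ^ (ρ - 1) ≤ 2 * N := hω
              simp only [hω, Set.indicator_of_mem, Set.mem_ofPred_eq, hω']
              ring
            · have hω' : ¬ ENNReal.ofReal t * (‖k ω‖ₑ * V ω) ^ (ρ - 1) ≤ 2 * N := hω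
              simp only [hω, Set.indicator_of_notMem, Set.mem_ofPred_eq, hω', not_false_eq_true,
                mul_zero]
    -- For fixed ω with |k|V ≠ 0, membership in `S t` bounds t from above, so after Fubini the
    -- t-integral of t^(τ-3) is finite because τ > 2.
    _ = ENNReal.ofReal τ * ∫⁻ ω, 4 * ((‖k ω‖ₑ ^ (2 : ℝ) * V ω) * ∫⁻ t in Set.Ioi 0,
          {t : ℝ | ENNReal.ofReal t * (‖k ω‖ₑ * V ω) ^ (ρ - 1) ≤ 2 * N}.indicator
          (fun t => ENNReal.ofReal (t ^ (τ - 3))) t) ∂μ := by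
        rw [lintegral_lintegral_swap]
        · congr 2; ext ω
          have hms : MeasurableSet {t : ℝ | ENNReal.ofReal t * (‖k ω‖ₑ * V ω) ^ (ρ - 1) ≤ 2 * N} :=
            measurableSet_le (by fun_prop) (by fun_prop)
          have hmi : Measurable ({t : ℝ | ENNReal.ofReal t * (‖k ω‖ₑ * V ω) ^ (ρ - 1) ≤ 2 * N}.indicator
            (fun t => ENNReal.ofReal (t ^ (τ - 3)))) := Measurable.indicator (by fun_prop) hms
          rw [lintegral_const_mul _ (by fun_prop), lintegral_const_mul _ hmi]
        · refine Measurable.aemeasurable ?_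
          have hms : MeasurableSet {z : ℝ × Ω |
              ENNReal.ofReal z.1 * (‖k z.2‖ₑ * V z.2) ^ (ρ - 1) ≤ 2 * N} :=
            measurableSet_le (by fun_prop) (by fun_prop)
          have hmi : Measurable ({z : ℝ × Ω |
              ENNReal.ofReal z.1 * (‖k z.2‖ₑ * V z.2) ^ (ρ - 1) ≤ 2 * N}.indicator
              fun z => ENNReal.ofReal (z.1 ^ (τ - 3))) := Measurable.indicator (by fun_prop) hms
          have : Measurable fun z : ℝ × Ω => 4 * ((‖k z.2‖ₑ ^ (2 : ℝ) * V z.2) * ({z : ℝ × Ω |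
              ENNReal.ofReal z.1 * (‖k z.2‖ₑ * V z.2) ^ (ρ - 1) ≤ 2 * N}.indicator
              fun z => ENNReal.ofReal (z.1 ^ (τ - 3))) z) := by fun_prop
          exact this
    _ ≤ ENNReal.ofReal τ * ∫⁻ ω, 4 * (ENNReal.ofReal (2 ^ (τ - 2) / (τ - 2)) * N ^ (τ - 2) *
          (‖k ω‖ₑ ^ ρ * (V ω : ℝ≥0∞) ^ (ρ - 1))) ∂μ := by
        gcongr ENNReal.ofReal τ * ?_
        refine lintegral_mono fun ω => ?_
        gcongr 4 * ?_
        exact sq_mul_weight_mul_lintegral_le hτ hρ enorm_ne_top ENNReal.coe_ne_top hNtop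
    _ = _ := by
        rw [lintegral_const_mul _ (by fun_prop), lintegral_const_mul _ (by fun_prop), ← hN]
        have e1 : N ^ (τ - 1) = N ^ (τ - 2) * N := by
          rw [show τ - 1 = (τ - 2) + 1 by ring, ENNReal.rpow_add_of_nonneg _ _ (by linarith)
            zero_le_one, ENNReal.rpow_one]
        rw [e1, ENNReal.ofReal_mul (by linarith), ENNReal.ofReal_mul (by norm_num)]
        simp only [ENNReal.ofReal_ofNat]
        ring

/-! ### The bilinear estimate for the parabola -/

@[fun_prop] theorem measurable_nnabs : Measurable fun x : ℝ => Real.nnabs x := by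
  have : (fun x : ℝ => Real.nnabs x) = fun x => Real.toNNReal |x| := by
    ext x; simp
  rw [this]; fun_prop

theorem lintegral_comp_mul_left {φ : ℝ → ℝ≥0∞} (hφ : Measurable φ) {a : ℝ} (ha : a ≠ 0) :
    ∫⁻ x, φ (a * x) = ENNReal.ofReal |a⁻¹| * ∫⁻ x, φ x := by
  rw [← lintegral_map hφ (measurable_const_mul a), Real.map_volume_mul_left ha,
    lintegral_smul_measure, smul_eq_mul]

/-- The `L²` estimate for the bilinear form of the parabola, with the Jacobian weight `1 / (2|d|)`. -/
theorem lintegral_bilinear_parabola_sq_le {k : ℝ × ℝ → ℂ} (hk : Measurable k)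
    (hki : Integrable k) :
    ∫⁻ y : ℝ × ℝ, ‖∫ ω : ℝ × ℝ, k ω * chi (ω.1 * y.1 + (ω.1 ^ 2 * y.2 + ω.2 * (2 * ω.1 * y.2)))‖ₑ
        ^ (2 : ℝ) ≤ ∫⁻ ω : ℝ × ℝ, ‖k ω‖ₑ ^ (2 : ℝ) * ((Real.nnabs (2 * ω.1))⁻¹ : ℝ≥0) := by
  -- Two one-dimensional Plancherel steps replace the change of variables (d, t) ↦ (d, d² + 2dt):
  -- first d against x with z fixed, then t against 2dz with d fixed. The dilation by 2d produces
  -- the weight.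
  set G : ℝ → ℝ → ℂ := fun z d => ∫ t, k (d, t) * chi (d ^ 2 * z + t * (2 * d * z)) with hG
  have hGm : Measurable (Function.uncurry G) := by
    have : StronglyMeasurable fun p : ℝ × ℝ =>
        ∫ t, k (p.2, t) * chi (p.2 ^ 2 * p.1 + t * (2 * p.2 * p.1)) := by
      refine StronglyMeasurable.integral_prod_right (Measurable.stronglyMeasurable ?_)
      simp only [Function.uncurry_def]
      fun_prop
    exact this.measurable
  have hintegrable : ∀ z, Integrable (fun ω : ℝ × ℝ => k ω * chi (ω.1 ^ 2 * z + ω.2 * (2 * ω.1 * z))) :=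
    fun z => integrable_mul_chi hki (by fun_prop)
  have hGi : ∀ z, Integrable (G z) := fun z => (hintegrable z).integral_prod_left
  have hrep : ∀ x z : ℝ, ∫ ω : ℝ × ℝ, k ω * chi (ω.1 * x + (ω.1 ^ 2 * z + ω.2 * (2 * ω.1 * z)))
      = ∫ d, G z d * chi (d * x) := by
    intro x z
    rw [Measure.volume_eq_prod, integral_prod _ (integrable_mul_chi hki (by fun_prop))]
    congr 1; ext d
    rw [hG, ← integral_mul_const]
    congr 1; ext t
    rw [chi_add]; ring
  have hslice : ∀ᵐ d : ℝ, ∫⁻ z, ‖G z d‖ₑ ^ (2 : ℝ) ≤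
      ∫⁻ t, ‖k (d, t)‖ₑ ^ (2 : ℝ) * ((Real.nnabs (2 * d))⁻¹ : ℝ≥0) := by
    filter_upwards [hki.prod_right_ae, Measure.ae_ne volume (0 : ℝ)] with d hd hd0
    have e1 : ∀ z, ‖G z d‖ₑ ^ (2 : ℝ) = ‖∫ t, k (d, t) * chi (t * ((2 * d) * z))‖ₑ ^ (2 : ℝ) := by
      intro z
      have : G z d = chi (d ^ 2 * z) * ∫ t, k (d, t) * chi (t * ((2 * d) * z)) := by
        rw [← integral_const_mul]
        refine integral_congr_ae (Filter.Eventually.of_forall fun t => ?_)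
        simp only
        rw [chi_add]; ring
      rw [this, enorm_mul, enorm_chi, one_mul]
    simp_rw [e1]
    have hm : Measurable fun y => ‖∫ t, k (d, t) * chi (t * y)‖ₑ ^ (2 : ℝ) := by
      have : StronglyMeasurable fun y => ∫ t, k (d, t) * chi (t * y) := by
        refine StronglyMeasurable.integral_prod_right (Measurable.stronglyMeasurable ?_)
        simp only [Function.uncurry_def]
        fun_prop
      have := this.measurable
      fun_prop
    have h2d : 2 * d ≠ 0 := by positivity
    rw [lintegral_comp_mul_left hm h2d]
    rw [lintegral_mul_const _ (by fun_prop), mul_comm]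
    have e2 : ENNReal.ofReal |(2 * d)⁻¹| = (((Real.nnabs (2 * d))⁻¹ : ℝ≥0) : ℝ≥0∞) := by
      rw [abs_inv, ENNReal.ofReal, ← Real.nnabs_of_nonneg (by positivity)]
      congr 1; ext; simp
    rw [e2]
    refine mul_le_mul_left ?_ _
    exact lintegral_enorm_integral_mul_chi_sq_le hd
  calc _ = ∫⁻ z : ℝ, ∫⁻ x : ℝ, ‖∫ d, G z d * chi (d * x)‖ₑ ^ (2 : ℝ) := by
        rw [Measure.volume_eq_prod, lintegral_prod_symm]
        · simp_rw [← Measure.volume_eq_prod, hrep]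
        · refine Measurable.aemeasurable ?_
          have : StronglyMeasurable fun y : ℝ × ℝ => ∫ ω : ℝ × ℝ,
              k ω * chi (ω.1 * y.1 + (ω.1 ^ 2 * y.2 + ω.2 * (2 * ω.1 * y.2))) := by
            refine StronglyMeasurable.integral_prod_right (Measurable.stronglyMeasurable ?_)
            simp only [Function.uncurry_def]
            fun_prop
          have := this.measurable
          fun_prop
    _ ≤ ∫⁻ z : ℝ, ∫⁻ d : ℝ, ‖G z d‖ₑ ^ (2 : ℝ) :=
        lintegral_mono fun z => lintegral_enorm_integral_mul_chi_sq_le (hGi z)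
    _ = ∫⁻ d : ℝ, ∫⁻ z : ℝ, ‖G z d‖ₑ ^ (2 : ℝ) := by
        refine lintegral_lintegral_swap (Measurable.aemeasurable ?_)
        exact (hGm.enorm.pow_const _)
    _ ≤ ∫⁻ d : ℝ, ∫⁻ t, ‖k (d, t)‖ₑ ^ (2 : ℝ) * ((Real.nnabs (2 * d))⁻¹ : ℝ≥0) :=
        lintegral_mono_ae hslice
    _ = _ := by
        rw [Measure.volume_eq_prod, lintegral_prod]
        refine Measurable.aemeasurable ?_
        fun_prop

/-- Only the factor 2 is lost. At d = 0 the inverse in `ℝ≥0` is 0 while the right side is ∞. -/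
theorem inv_nnabs_two_mul_rpow_le {r : ℝ} (hr : 0 < r) (d : ℝ) :
    (((Real.nnabs (2 * d))⁻¹ : ℝ≥0) : ℝ≥0∞) ^ r ≤ ENNReal.ofReal |d| ^ (-r) := by
  rcases eq_or_ne d 0 with rfl | hd
  · simp [hr]
  have h : Real.nnabs (2 * d) ≠ 0 := by simpa using hd
  rw [ENNReal.coe_inv h, ENNReal.inv_rpow, ENNReal.rpow_neg]
  gcongr
  rw [ENNReal.ofReal, ENNReal.coe_le_coe]
  rw [← NNReal.coe_le_coe, Real.coe_toNNReal _ (abs_nonneg d), Real.coe_nnabs, abs_mul]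
  have := abs_nonneg d
  norm_num; linarith

/-- Shear (d, t) ↦ (d + t, t) in the double integral. The phase comes from (d + t)² - t² = d² + 2dt.
-/
theorem integral_chi_parabola_mul_conj {g : ℝ → ℂ} (x z : ℝ) :
    (∫ s, g s * chi (s * x + s ^ 2 * z)) * (starRingEnd ℂ) (∫ s, g s * chi (s * x + s ^ 2 * z)) =
      ∫ ω : ℝ × ℝ, (g (ω.1 + ω.2) * (starRingEnd ℂ) (g ω.2)) *
        chi (ω.1 * x + (ω.1 ^ 2 * z + ω.2 * (2 * ω.1 * z))) := by
  rw [← integral_conj, ← integral_prod_mul]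
  have hmp := measurePreserving_add_prod (volume : Measure ℝ) (volume : Measure ℝ)
  have hme : MeasurableEmbedding fun z : ℝ × ℝ => (z.1 + z.2, z.2) :=
    (MeasurableEquiv.measurableEmbedding
      { toFun := fun z : ℝ × ℝ => (z.1 + z.2, z.2)
        invFun := fun z : ℝ × ℝ => (z.1 - z.2, z.2)
        left_inv := fun z => by simp
        right_inv := fun z => by simp
        measurable_toFun := by simp only [Equiv.coe_fn_mk]; fun_prop
        measurable_invFun := by simp only [Equiv.coe_fn_symm_mk]; fun_prop })
  rw [← hmp.integral_comp hme, ← Measure.volume_eq_prod]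
  congr 1; ext ω
  simp only [map_mul, conj_chi]
  have : chi (ω.1 * x + (ω.1 ^ 2 * z + ω.2 * (2 * ω.1 * z))) =
      chi ((ω.1 + ω.2) * x + (ω.1 + ω.2) ^ 2 * z) * chi (-(ω.2 * x + ω.2 ^ 2 * z)) := by
    rw [← chi_add]; congr 1; ring
  rw [this]; ring

/-- The restriction estimate for the parabola in bilinear form. -/
theorem lintegral_parabola_rpow_le {q τ ρ : ℝ} (hq : q = 2 * τ) (hτ : 2 < τ) (hρ : ρ = τ / (τ - 1))
    {g : ℝ → ℂ} (hg : Measurable g) (hgi : Integrable g) :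
    ∫⁻ y : ℝ × ℝ, ‖∫ s, g s * chi (s * y.1 + s ^ 2 * y.2)‖ₑ ^ q ≤
      ENNReal.ofReal (4 * τ * (2 ^ (τ - 2) / (τ - 2))) *
        (∫⁻ ω : ℝ × ℝ, (‖g ω.1‖ₑ ^ ρ * ‖g ω.2‖ₑ ^ ρ) *
          ENNReal.ofReal |ω.1 - ω.2| ^ (-(ρ - 1))) ^ (τ - 1) := by
  have hρ1 : 0 < ρ - 1 := by
    rw [hρ, sub_pos, lt_div_iff₀ (by linarith)]; linarith
  set k : ℝ × ℝ → ℂ := fun ω => g (ω.1 + ω.2) * (starRingEnd ℂ) (g ω.2) with hk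
  have hkm : Measurable k := by
    have : Measurable fun ω : ℝ × ℝ => (starRingEnd ℂ) (g ω.2) :=
      (Complex.continuous_conj.measurable).comp (hg.comp measurable_snd)
    fun_prop
  have hmp := measurePreserving_add_prod (volume : Measure ℝ) (volume : Measure ℝ)
  have hgc : Integrable fun s => (starRingEnd ℂ) (g s) := by
    refine hgi.congr' ?_ (Filter.Eventually.of_forall fun s => by simp)
    exact ((Complex.continuous_conj.measurable).comp hg).aestronglyMeasurable
  have hki : Integrable k := by
    have := hgi.mul_prod hgc
    exact hmp.integrable_comp_of_integrable this
  have hmain := lintegral_enorm_integral_rpow_le (μ := (volume : Measure (ℝ × ℝ)))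
    (ν := (volume : Measure (ℝ × ℝ)))
    (e := fun y ω => chi (ω.1 * y.1 + (ω.1 ^ 2 * y.2 + ω.2 * (2 * ω.1 * y.2))))
    (V := fun ω => (Real.nnabs (2 * ω.1))⁻¹)
    (by simp only [Function.uncurry_def]; fun_prop) (fun y ω => by simp) (by fun_prop)
    (fun k hk hki => lintegral_bilinear_parabola_sq_le hk hki) hτ hρ hkm hki
  calc _ = ∫⁻ y : ℝ × ℝ, ‖∫ ω : ℝ × ℝ, k ω *
        chi (ω.1 * y.1 + (ω.1 ^ 2 * y.2 + ω.2 * (2 * ω.1 * y.2)))‖ₑ ^ τ := by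
        congr 1; ext y
        rw [hk, ← integral_chi_parabola_mul_conj, enorm_mul]
        have : ∀ w : ℂ, ‖(starRingEnd ℂ) w‖ₑ = ‖w‖ₑ := fun w => by
          rw [← ofReal_norm, ← ofReal_norm, RCLike.norm_conj]
        rw [this, ← pow_two, ← ENNReal.rpow_two, ← ENNReal.rpow_mul, hq]
    _ ≤ _ := hmain
    _ ≤ _ := by
        gcongr ENNReal.ofReal _ * ?_
        refine ENNReal.rpow_le_rpow ?_ (by linarith)
        have hF : Measurable fun ω : ℝ × ℝ => (‖g ω.1‖ₑ ^ ρ * ‖g ω.2‖ₑ ^ ρ) *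
          ENNReal.ofReal |ω.1 - ω.2| ^ (-(ρ - 1)) := by fun_prop
        rw [Measure.volume_eq_prod, ← hmp.lintegral_comp hF]
        refine lintegral_mono fun ω => ?_
        have : ∀ w : ℂ, ‖(starRingEnd ℂ) w‖ₑ = ‖w‖ₑ := fun w => by
          rw [← ofReal_norm, ← ofReal_norm, RCLike.norm_conj]
        simp only [hk, enorm_mul, this, add_sub_cancel_right]
        rw [ENNReal.mul_rpow_of_nonneg _ _ (by linarith)]
        gcongr
        exact inv_nnabs_two_mul_rpow_le hρ1 _

/-! ### Fractional integration on [-1, 1] and the weighted parabola estimate -/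

/-- Lebesgue measure on `[-1, 1]`. -/
noncomputable def intervalMeasure : Measure ℝ := volume.restrict (Set.Icc (-1) 1)

instance : IsFiniteMeasure intervalMeasure := by unfold intervalMeasure; infer_instance

theorem intervalMeasure_univ : intervalMeasure Set.univ = 2 := by
  simp [intervalMeasure]; norm_num

theorem ae_intervalMeasure_ne (s : ℝ) : ∀ᵐ t ∂intervalMeasure, t ≠ s :=
  ae_restrict_of_ae (Measure.ae_ne volume s)

theorem lintegral_Icc_abs_rpow_lt_top {r : ℝ} (hr : -1 < r) :
    ∫⁻ x in Set.Icc (-2 : ℝ) 2, ENNReal.ofReal |x| ^ r < ∞ := by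
  have hpos : ∫⁻ x in Set.Icc (0 : ℝ) 2, ENNReal.ofReal |x| ^ r < ∞ := by
    rw [setLIntegral_congr Ioc_ae_eq_Icc.symm,
      setLIntegral_congr_fun (g := fun x => ENNReal.ofReal (x ^ r)) measurableSet_Ioc]
    · rw [lintegral_Ioc_zero_rpow hr (by norm_num)]
      exact ENNReal.ofReal_lt_top
    · intro x hx
      simp only
      rw [abs_of_pos hx.1, ENNReal.ofReal_rpow_of_pos hx.1]
  have hneg : ∫⁻ x in Set.Icc (-2 : ℝ) 0, ENNReal.ofReal |x| ^ r < ∞ := by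
    have : ∫⁻ x in Set.Icc (-2 : ℝ) 0, ENNReal.ofReal |x| ^ r =
        ∫⁻ x in Set.Icc (0 : ℝ) 2, ENNReal.ofReal |x| ^ r := by
      rw [← lintegral_indicator measurableSet_Icc, ← lintegral_indicator measurableSet_Icc,
        ← lintegral_neg_eq_self]
      congr 1; ext x
      by_cases hx : x ∈ Set.Icc (0 : ℝ) 2
      · have hx' : -x ∈ Set.Icc (-2 : ℝ) 0 := ⟨by linarith [hx.2], by linarith [hx.1]⟩
        simp [hx, hx']
      · have hx' : -x ∉ Set.Icc (-2 : ℝ) 0 := fun h => hx ⟨by linarith [h.2], by linarith [h.1]⟩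
        rw [Set.indicator_of_notMem hx, Set.indicator_of_notMem hx']
    rw [this]; exact hpos
  have hU : Set.Icc (-2 : ℝ) 2 = Set.Icc (-2) 0 ∪ Set.Icc 0 2 :=
    (Set.Icc_union_Icc_eq_Icc (by norm_num) (by norm_num)).symm
  rw [hU]
  exact (lintegral_union_le _ _ _).trans_lt (ENNReal.add_lt_top.2 ⟨hneg, hpos⟩)

/-- For s and t in [-1, 1] the difference lies in [-2, 2], so the integral of |x|^r over [-2, 2] is
a uniform bound. -/
theorem exists_lintegral_abs_sub_rpow_le {r : ℝ} (hr : -1 < r) :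
    ∃ C : ℝ≥0, ∀ s ∈ Set.Icc (-1 : ℝ) 1, ∫⁻ t, ENNReal.ofReal |s - t| ^ r ∂intervalMeasure ≤ C := by
  refine ⟨(∫⁻ x in Set.Icc (-2 : ℝ) 2, ENNReal.ofReal |x| ^ r).toNNReal, fun s hs => ?_⟩
  rw [ENNReal.coe_toNNReal (lintegral_Icc_abs_rpow_lt_top hr).ne, intervalMeasure,
    ← lintegral_indicator measurableSet_Icc, ← lintegral_indicator measurableSet_Icc,
    ← lintegral_sub_left_eq_self _ s]
  refine lintegral_mono fun t => ?_
  by_cases ht : s - t ∈ Set.Icc (-1 : ℝ) 1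
  · have ht' : t ∈ Set.Icc (-2 : ℝ) 2 := ⟨by linarith [hs.1, ht.2], by linarith [hs.2, ht.1]⟩
    simp [ht, ht']
  · rw [Set.indicator_of_notMem ht]; exact zero_le

theorem lintegral_prod_le_of_kernel_le {K : ℝ × ℝ → ℝ≥0∞} (hK : Measurable K) {C : ℝ≥0}
    (hC : ∀ s ∈ Set.Icc (-1 : ℝ) 1, ∫⁻ t, K (s, t) ∂intervalMeasure ≤ C) {v : ℝ → ℝ≥0∞}
    (hv : Measurable v) :
    ∫⁻ ω, v ω.1 * K ω ∂(intervalMeasure.prod intervalMeasure) ≤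
      C * ∫⁻ s, v s ∂intervalMeasure := by
  rw [lintegral_prod _ (by fun_prop), ← lintegral_const_mul _ hv]
  unfold intervalMeasure at *
  refine setLIntegral_mono (by fun_prop) fun s hs => ?_
  simp only
  rw [lintegral_const_mul _ (by fun_prop), mul_comm]
  gcongr
  exact hC s hs

/-- A fractional-integration inequality on `[-1, 1]` with exponents slightly off the critical line. -/
theorem lintegral_mul_mul_kernel_rpow_le {ε κ σ : ℝ} (hε : 0 < ε) (hκ : κ = 3 / 2 + ε)
    (hσ : σ = κ / (1 + ε / 2)) :
    ∃ C : ℝ≥0, ∀ u : ℝ → ℝ≥0∞, Measurable u →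
      (∫⁻ ω, u ω.1 * u ω.2 * ENNReal.ofReal |ω.1 - ω.2| ^ (-(1 / κ))
        ∂(intervalMeasure.prod intervalMeasure)) ^ κ ≤
      C * (∫⁻ s, u s ^ σ ∂intervalMeasure) ^ (2 + ε) := by
  obtain ⟨C, hC⟩ := exists_lintegral_abs_sub_rpow_le (r := -(1 / (1 + ε)))
    (by rw [neg_lt_neg_iff, div_lt_one (by linarith)]; linarith)
  refine ⟨C ^ (1 + ε), fun u hu => ?_⟩
  have hκ0 : 0 < κ := by rw [hκ]; linarith
  have hσ0 : 0 ≤ σ := by rw [hσ]; positivity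
  set A := ∫⁻ s, u s ^ σ ∂intervalMeasure with hA
  -- Hölder exponents a, a, c for the factors u(s)^σ K, u(t)^σ K and u(s)^σ u(t)^σ. They are
  -- determined by 2a + c = 1, σ(a + c) = 1 and K^(2a) = |s - t|^(-1/κ). The kernel exponent 1/(1 +
  -- ε) < 1 leaves K integrable.
  set a : ℝ := (1 + ε) / (2 * κ) with ha
  set c : ℝ := 1 / (2 * κ) with hc
  have ha0 : 0 ≤ a := by positivity
  have hc0 : 0 ≤ c := by positivity
  set K : ℝ × ℝ → ℝ≥0∞ := fun ω => ENNReal.ofReal |ω.1 - ω.2| ^ (-(1 / (1 + ε))) with hK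
  have hKm : Measurable K := by fun_prop
  have hσac : σ * a + σ * c = 1 := by
    rw [hσ, ha, hc]; field_simp; ring
  have hac : a + a + c = 1 := by
    rw [ha, hc, hκ]; field_simp; ring
  have hpt : ∀ ω : ℝ × ℝ, u ω.1 * u ω.2 * ENNReal.ofReal |ω.1 - ω.2| ^ (-(1 / κ)) =
      (u ω.1 ^ σ * K ω) ^ a * (u ω.2 ^ σ * K ω) ^ a * (u ω.1 ^ σ * u ω.2 ^ σ) ^ c := by
    intro ω
    have e1 : ∀ x : ℝ≥0∞, x ^ (σ * a) * x ^ (σ * c) = x := fun x => by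
      rw [← ENNReal.rpow_add_of_nonneg _ _ (by positivity) (by positivity), hσac, ENNReal.rpow_one]
    have e2 : K ω ^ a * K ω ^ a = ENNReal.ofReal |ω.1 - ω.2| ^ (-(1 / κ)) := by
      rw [← ENNReal.rpow_add_of_nonneg _ _ ha0 ha0, hK, ← ENNReal.rpow_mul]
      congr 1
      rw [ha]; field_simp; ring
    simp only [ENNReal.mul_rpow_of_nonneg _ _ ha0, ENNReal.mul_rpow_of_nonneg _ _ hc0,
      ← ENNReal.rpow_mul]
    calc _ = (u ω.1 ^ (σ * a) * u ω.1 ^ (σ * c)) * (u ω.2 ^ (σ * a) * u ω.2 ^ (σ * c)) *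
          (K ω ^ a * K ω ^ a) := by rw [e1, e1, e2]
      _ = _ := by ring
  have h1 : ∫⁻ ω, u ω.1 ^ σ * K ω ∂(intervalMeasure.prod intervalMeasure) ≤ C * A :=
    lintegral_prod_le_of_kernel_le hKm hC (v := fun s => u s ^ σ) (by fun_prop)
  have h2 : ∫⁻ ω, u ω.2 ^ σ * K ω ∂(intervalMeasure.prod intervalMeasure) ≤ C * A := by
    rw [← lintegral_prod_swap]
    refine le_trans (le_of_eq ?_) h1
    congr 1; ext ω
    simp [hK, abs_sub_comm]
  have h3 : ∫⁻ ω, u ω.1 ^ σ * u ω.2 ^ σ ∂(intervalMeasure.prod intervalMeasure) = A * A :=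
    lintegral_prod_mul (hu.pow_const σ).aemeasurable (hu.pow_const σ).aemeasurable
  have hH := ENNReal.lintegral_prod_norm_pow_le (μ := intervalMeasure.prod intervalMeasure)
    (Finset.univ : Finset (Fin 3))
    (f := ![fun ω => u ω.1 ^ σ * K ω, fun ω => u ω.2 ^ σ * K ω, fun ω => u ω.1 ^ σ * u ω.2 ^ σ])
    (p := ![a, a, c])
    (by intro i _; fin_cases i <;> simp <;> fun_prop)
    (by simp [Fin.sum_univ_three, hac])
    (by intro i _; fin_cases i <;> simp [ha0, hc0])
  simp only [Fin.prod_univ_three, Matrix.cons_val] at hH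
  simp_rw [hpt]
  calc _ ≤ ((C * A) ^ a * (C * A) ^ a * (A * A) ^ c) ^ κ := by
        refine ENNReal.rpow_le_rpow (hH.trans ?_) hκ0.le
        rw [h3]
        gcongr
    _ = ((C * A) ^ (1 + ε)) * A := by
        rw [← ENNReal.rpow_add_of_nonneg _ _ ha0 ha0, ENNReal.mul_rpow_of_nonneg _ _ hκ0.le,
          ← ENNReal.rpow_mul, ← ENNReal.rpow_mul]
        have e1 : (a + a) * κ = 1 + ε := by rw [ha]; field_simp; ring
        have e2 : c * κ = 1 / 2 := by rw [hc]; field_simp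
        rw [e1, e2, ← pow_two, ← ENNReal.rpow_two, ← ENNReal.rpow_mul]
        norm_num
    _ = _ := by
        rw [ENNReal.mul_rpow_of_nonneg _ _ (by linarith), mul_assoc,
          ENNReal.coe_rpow_of_nonneg _ (by linarith)]
        congr 1
        nth_rw 2 [← ENNReal.rpow_one A]
        rw [← ENNReal.rpow_add_of_nonneg _ _ (by linarith) zero_le_one]
        congr 1; ring

/-- Since σ < κ, Hölder has room to insert a weight that vanishes on the diagonal: a power of the
integrable |s - t|^(-1/2) compensates for it. The exponent ε/4 is the one for which the powers of |s
- t| cancel, (ε/4) b = (1 - b)/2 with b = 1/(1 + ε/2). -/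
theorem lintegral_rpow_rpow_le_weighted {ε κ σ : ℝ} (hε : 0 < ε) (hκ : 0 < κ)
    (hσ : σ = κ / (1 + ε / 2)) :
    ∃ C : ℝ≥0, ∀ u : ℝ → ℝ≥0∞, Measurable u →
      (∫⁻ s, u s ^ σ ∂intervalMeasure) ^ (2 + ε) ≤
      C * ∫⁻ ω, u ω.1 ^ κ * u ω.2 ^ κ * ENNReal.ofReal |ω.1 - ω.2| ^ (ε / 4)
        ∂(intervalMeasure.prod intervalMeasure) := by
  obtain ⟨C, hC⟩ := exists_lintegral_abs_sub_rpow_le (r := -(1 / 2)) (by norm_num)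
  refine ⟨(C * 2) ^ (ε / 2), fun u hu => ?_⟩
  have hσ0 : 0 ≤ σ := by rw [hσ]; positivity
  set b : ℝ := 1 / (1 + ε / 2) with hb
  have hb0 : 0 < b := by positivity
  have hb1 : 0 ≤ 1 - b := by
    rw [hb, sub_nonneg, div_le_one (by linarith)]; linarith
  set A := ∫⁻ s, u s ^ σ ∂intervalMeasure with hA
  set B := ∫⁻ ω, u ω.1 ^ κ * u ω.2 ^ κ * ENNReal.ofReal |ω.1 - ω.2| ^ (ε / 4)
        ∂(intervalMeasure.prod intervalMeasure) with hB
  have h3 : ∫⁻ ω, u ω.1 ^ σ * u ω.2 ^ σ ∂(intervalMeasure.prod intervalMeasure) = A * A :=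
    lintegral_prod_mul (hu.pow_const σ).aemeasurable (hu.pow_const σ).aemeasurable
  have h4 : ∫⁻ ω, ENNReal.ofReal |ω.1 - ω.2| ^ (-(1 / 2) : ℝ)
      ∂(intervalMeasure.prod intervalMeasure) ≤ C * 2 := by
    have := lintegral_prod_le_of_kernel_le
      (K := fun ω => ENNReal.ofReal |ω.1 - ω.2| ^ (-(1 / 2) : ℝ)) (by fun_prop) hC (v := fun _ => 1)
      (by fun_prop)
    simpa [intervalMeasure_univ] using this
  have hdiag : ∀ᵐ ω ∂(intervalMeasure.prod intervalMeasure), ω.2 ≠ ω.1 := by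
    rw [Measure.ae_prod_iff_ae_ae]
    · exact Filter.Eventually.of_forall fun s => ae_intervalMeasure_ne s
    · exact (measurableSet_eq_fun measurable_snd measurable_fst).compl
  have hH : A * A ≤ B ^ b * (C * 2) ^ (1 - b) := by
    rw [← h3]
    calc _ ≤ ∫⁻ ω, (u ω.1 ^ κ * u ω.2 ^ κ * ENNReal.ofReal |ω.1 - ω.2| ^ (ε / 4)) ^ b *
          (ENNReal.ofReal |ω.1 - ω.2| ^ (-(1 / 2) : ℝ)) ^ (1 - b)
          ∂(intervalMeasure.prod intervalMeasure) := by
          refine lintegral_mono_ae ?_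
          filter_upwards [hdiag] with ω hω
          have hD : 0 < |ω.1 - ω.2| := abs_pos.2 (sub_ne_zero.2 (Ne.symm hω))
          rw [ENNReal.mul_rpow_of_nonneg _ _ hb0.le, ENNReal.mul_rpow_of_nonneg _ _ hb0.le,
            ← ENNReal.rpow_mul, ← ENNReal.rpow_mul, ← ENNReal.rpow_mul, ← ENNReal.rpow_mul, mul_assoc,
            ← ENNReal.rpow_add _ _ (by simpa using hD) (by simp)]
          have e1 : κ * b = σ := by rw [hσ, hb]; ring
          have e2 : ε / 4 * b + -(1 / 2) * (1 - b) = 0 := by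
            rw [hb]; field_simp; ring
          rw [e1, e2, ENNReal.rpow_zero, mul_one]
      _ ≤ _ := ENNReal.lintegral_mul_norm_pow_le (by fun_prop) (by fun_prop) hb0.le hb1 (by ring)
      _ ≤ _ := by gcongr
  calc A ^ (2 + ε) = (A * A) ^ (1 + ε / 2) := by
        rw [← pow_two, ← ENNReal.rpow_two, ← ENNReal.rpow_mul]; congr 1; ring
    _ ≤ (B ^ b * (C * 2) ^ (1 - b)) ^ (1 + ε / 2) := ENNReal.rpow_le_rpow hH (by linarith)
    _ = _ := by
        rw [ENNReal.mul_rpow_of_nonneg _ _ (by linarith), ← ENNReal.rpow_mul, ← ENNReal.rpow_mul]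
        have e1 : b * (1 + ε / 2) = 1 := by rw [hb]; field_simp
        have e2 : (1 - b) * (1 + ε / 2) = ε / 2 := by rw [sub_mul, e1]; ring
        rw [e1, e2, ENNReal.rpow_one, mul_comm, ENNReal.coe_rpow_of_nonneg _ (by linarith)]
        simp

/-- The parabola estimate for functions supported on `[-1, 1]`, with the weight `|s - t|^(ε/4)`. -/
theorem exists_lintegral_parabola_rpow_le {ε q : ℝ} (hε : 0 < ε) (hq : q = 5 + 2 * ε) :
    ∃ C : ℝ≥0, ∀ g : ℝ → ℂ, Measurable g → Integrable g → (∀ s ∉ Set.Icc (-1 : ℝ) 1, g s = 0) →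
      ∫⁻ y : ℝ × ℝ, ‖∫ s, g s * chi (s * y.1 + s ^ 2 * y.2)‖ₑ ^ q ≤
        C * ∫⁻ ω, ‖g ω.1‖ₑ ^ (q / 2) * ‖g ω.2‖ₑ ^ (q / 2) * ENNReal.ofReal |ω.1 - ω.2| ^ (ε / 4)
          ∂(intervalMeasure.prod intervalMeasure) := by
  set κ : ℝ := 3 / 2 + ε with hκ
  have hκ0 : 0 < κ := by positivity
  obtain ⟨C₁, h₁⟩ := lintegral_mul_mul_kernel_rpow_le hε hκ rfl
  obtain ⟨C₂, h₂⟩ := lintegral_rpow_rpow_le_weighted hε hκ0 rfl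
  set τ := q / 2 with hτ
  set ρ := τ / (τ - 1) with hρ
  -- With τ - 1 = κ and ρ - 1 = 1/κ, the kernel and outer power from Hausdorff–Young are those of
  -- the fractional integration bound for u = |g|^ρ, and u^κ = |g|^(q/2).
  have hτκ : τ - 1 = κ := by rw [hτ, hκ, hq]; ring
  have hρ1 : ρ - 1 = 1 / κ := by
    rw [hρ, hτκ, div_sub_one hκ0.ne', ← hτκ]; ring
  refine ⟨(4 * τ * (2 ^ (τ - 2) / (τ - 2))).toNNReal * C₁ * C₂, fun g hg hgi hsupp => ?_⟩
  have hρ0 : 0 < ρ := by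
    have : 0 < 1 / κ := by positivity
    linarith
  have hmain := lintegral_parabola_rpow_le (q := q) (τ := τ) (by rw [hτ]; ring) (by rw [hτ, hq]; linarith)
    hρ hg hgi
  have hres : ∫⁻ ω : ℝ × ℝ, (‖g ω.1‖ₑ ^ ρ * ‖g ω.2‖ₑ ^ ρ) *
          ENNReal.ofReal |ω.1 - ω.2| ^ (-(ρ - 1)) =
      ∫⁻ ω, ‖g ω.1‖ₑ ^ ρ * ‖g ω.2‖ₑ ^ ρ * ENNReal.ofReal |ω.1 - ω.2| ^ (-(1 / κ))
        ∂(intervalMeasure.prod intervalMeasure) := by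
    rw [hρ1, intervalMeasure, Measure.prod_restrict, ← Measure.volume_eq_prod,
      ← lintegral_indicator (measurableSet_Icc.prod measurableSet_Icc)]
    congr 1; ext ω
    by_cases hω : ω ∈ Set.Icc (-1 : ℝ) 1 ×ˢ Set.Icc (-1 : ℝ) 1
    · rw [Set.indicator_of_mem hω]
    · rw [Set.indicator_of_notMem hω]
      rw [Set.mem_prod, not_and_or] at hω
      rcases hω with h | h <;> simp [hsupp _ h, ENNReal.zero_rpow_of_pos hρ0]
  rw [hres, hτκ] at hmain
  have e3 := h₁ (fun s => ‖g s‖ₑ ^ ρ) (by fun_prop)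
  have e4 := h₂ (fun s => ‖g s‖ₑ ^ ρ) (by fun_prop)
  have e5 : ρ * κ = τ := by rw [hρ, hτκ]; field_simp
  simp only [← ENNReal.rpow_mul _ ρ κ, e5] at e4
  calc _ ≤ _ := hmain
    _ ≤ ENNReal.ofReal (4 * τ * (2 ^ (τ - 2) / (τ - 2))) * (C₁ * (C₂ * _)) := by
        gcongr ENNReal.ofReal _ * ?_
        refine e3.trans ?_
        gcongr
    _ = _ := by
        rw [ENNReal.ofReal]; push_cast; ring

/-! ### Fibering over (b, d) and the partial Fourier transform -/

/-- Transversality of two families of lines: translating the first coordinate makes `P` independent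
of the second, and a dilation by t - s then separates `Q`. -/
theorem lintegral_lines {P Q : ℝ → ℝ≥0∞} (hP : Measurable P) (hQ : Measurable Q) {s t : ℝ}
    (hst : t ≠ s) :
    ∫⁻ c : ℝ × ℝ, P (c.1 + s * c.2) * Q (c.1 + t * c.2) =
      ENNReal.ofReal |s - t|⁻¹ * ((∫⁻ y, P y) * ∫⁻ y, Q y) := by
  have hd : t - s ≠ 0 := sub_ne_zero.2 hst
  calc _ = ∫⁻ a : ℝ, ∫⁻ b : ℝ, P (b + s * a) * Q (b + t * a) := by
        rw [Measure.volume_eq_prod, lintegral_prod_symm _ (by fun_prop)]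
    _ = ∫⁻ a : ℝ, ∫⁻ b : ℝ, P b * Q (b + (t - s) * a) := by
        congr 1; ext a
        rw [← lintegral_add_right_eq_self (fun b => P b * Q (b + (t - s) * a)) (s * a)]
        congr 1; ext b
        congr 2; ring
    _ = ∫⁻ b : ℝ, ∫⁻ a : ℝ, P b * Q (b + (t - s) * a) := by
        refine lintegral_lintegral_swap (Measurable.aemeasurable ?_)
        simp only [Function.uncurry_def]; fun_prop
    _ = ∫⁻ b : ℝ, P b * (ENNReal.ofReal |s - t|⁻¹ * ∫⁻ y, Q y) := by
        congr 1; ext b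
        rw [lintegral_const_mul _ (by fun_prop), lintegral_comp_mul_left (φ := fun x => Q (b + x))
          (by fun_prop) hd, lintegral_add_left_eq_self, abs_inv, abs_sub_comm]
    _ = _ := by
        rw [lintegral_mul_const _ hP]; ring

/-- The partial Fourier transform in the second variable. -/
noncomputable def partialFourier (φ : ℝ × ℝ → ℂ) (s y : ℝ) : ℂ := ∫ w, φ (s, w) * chi (w * y)

theorem measurable_partialFourier {φ : ℝ × ℝ → ℂ} (hφ : Measurable φ) :
    Measurable (Function.uncurry (partialFourier φ)) := by
  have : StronglyMeasurable fun p : ℝ × ℝ => ∫ w, φ (p.1, w) * chi (w * p.2) := by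
    refine StronglyMeasurable.integral_prod_right (Measurable.stronglyMeasurable ?_)
    simp only [Function.uncurry_def]
    fun_prop
  exact this.measurable

theorem lintegral_slice_le_two {φ : ℝ × ℝ → ℂ} (hφ1 : ∀ z, ‖φ z‖ₑ ≤ 1)
    (hsupp : ∀ z ∉ Set.Icc (-1 : ℝ) 1 ×ˢ Set.Icc (-1 : ℝ) 1, φ z = 0) (s : ℝ) : ∫⁻ w, ‖φ (s, w)‖ₑ ≤ 2 := by
  calc _ ≤ ∫⁻ w, (Set.Icc (-1 : ℝ) 1).indicator (fun _ => (1 : ℝ≥0∞)) w := by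
        refine lintegral_mono fun w => ?_
        by_cases hw : w ∈ Set.Icc (-1 : ℝ) 1
        · rw [Set.indicator_of_mem hw]; exact hφ1 _
        · rw [hsupp _ (fun h => hw h.2)]; simp
    _ = 2 := by
        rw [lintegral_indicator measurableSet_Icc]; simp; norm_num

theorem integrable_slice {φ : ℝ × ℝ → ℂ} (hφ : Measurable φ) (hφ1 : ∀ z, ‖φ z‖ₑ ≤ 1)
    (hsupp : ∀ z ∉ Set.Icc (-1 : ℝ) 1 ×ˢ Set.Icc (-1 : ℝ) 1, φ z = 0) (s : ℝ) : Integrable fun w => φ (s, w) :=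
  ⟨(hφ.comp measurable_prodMk_left).aestronglyMeasurable,
    (lintegral_slice_le_two hφ1 hsupp s).trans_lt (by simp)⟩

theorem enorm_partialFourier_le {φ : ℝ × ℝ → ℂ} (hφ1 : ∀ z, ‖φ z‖ₑ ≤ 1)
    (hsupp : ∀ z ∉ Set.Icc (-1 : ℝ) 1 ×ˢ Set.Icc (-1 : ℝ) 1, φ z = 0) (s y : ℝ) : ‖partialFourier φ s y‖ₑ ≤ 2 := by
  refine (enorm_integral_le_lintegral_enorm _).trans (le_trans (le_of_eq ?_)
    (lintegral_slice_le_two hφ1 hsupp s))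
  simp

theorem partialFourier_eq_zero {φ : ℝ × ℝ → ℂ}
    (hsupp : ∀ z ∉ Set.Icc (-1 : ℝ) 1 ×ˢ Set.Icc (-1 : ℝ) 1, φ z = 0) {s : ℝ} (hs : s ∉ Set.Icc (-1 : ℝ) 1) (y : ℝ) :
    partialFourier φ s y = 0 := by
  unfold partialFourier
  have : ∀ w, φ (s, w) = 0 := fun w => hsupp _ fun h => hs h.1
  simp [this]

/-- The sup bound 2 lowers the exponent r to 2, Plancherel applies, and |φ|² ≤ |φ| because |φ| ≤ 1.
-/
theorem lintegral_partialFourier_rpow_le {φ : ℝ × ℝ → ℂ} (hφ : Measurable φ) (hφ1 : ∀ z, ‖φ z‖ₑ ≤ 1)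
    (hsupp : ∀ z ∉ Set.Icc (-1 : ℝ) 1 ×ˢ Set.Icc (-1 : ℝ) 1, φ z = 0) {r : ℝ} (hr : 2 ≤ r) (s : ℝ) :
    ∫⁻ y, ‖partialFourier φ s y‖ₑ ^ r ≤ 2 ^ (r - 2) * ∫⁻ w, ‖φ (s, w)‖ₑ := by
  have hm : Measurable fun y => partialFourier φ s y :=
    (measurable_partialFourier hφ).comp measurable_prodMk_left
  calc _ ≤ ∫⁻ y, 2 ^ (r - 2) * ‖partialFourier φ s y‖ₑ ^ (2 : ℝ) := by
        refine lintegral_mono fun y => ?_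
        simp only
        rw [show r = (r - 2) + 2 by ring, ENNReal.rpow_add_of_nonneg _ _ (by linarith) (by norm_num),
          show r - 2 + 2 - 2 = r - 2 by ring]
        gcongr
        exact enorm_partialFourier_le hφ1 hsupp s y
    _ = 2 ^ (r - 2) * ∫⁻ y, ‖partialFourier φ s y‖ₑ ^ (2 : ℝ) := lintegral_const_mul _ (by fun_prop)
    _ ≤ 2 ^ (r - 2) * ∫⁻ w, ‖φ (s, w)‖ₑ := by
        gcongr 2 ^ (r - 2) * ?_
        refine (lintegral_enorm_integral_mul_chi_sq_le (integrable_slice hφ hφ1 hsupp s)).trans ?_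
        refine lintegral_mono fun w => ?_
        calc ‖φ (s, w)‖ₑ ^ (2 : ℝ) ≤ ‖φ (s, w)‖ₑ ^ (1 : ℝ) :=
              ENNReal.rpow_le_rpow_of_exponent_ge (hφ1 _) (by norm_num)
          _ = _ := ENNReal.rpow_one _

/-- The weighted parabola bound is applied on each fibre and the fibres are integrated before (s,
t). Transversality costs |s - t|⁻¹, leaving the integrable weight |s - t|^(ε/4 - 1). One slice norm
is bounded by 2; the other integrates to ‖φ‖₁. -/
theorem exists_lintegral_fibered_parabola_le {ε q : ℝ} (hε : 0 < ε) (hq : q = 5 + 2 * ε) :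
    ∃ C : ℝ≥0, ∀ φ : ℝ × ℝ → ℂ, Measurable φ → (∀ z, ‖φ z‖ₑ ≤ 1) →
      (∀ z ∉ Set.Icc (-1 : ℝ) 1 ×ˢ Set.Icc (-1 : ℝ) 1, φ z = 0) →
      ∫⁻ c : ℝ × ℝ, ∫⁻ y : ℝ × ℝ, ‖∫ s, partialFourier φ s (c.1 + s * c.2) *
        chi (s * y.1 + s ^ 2 * y.2)‖ₑ ^ q ≤ C * ∫⁻ z, ‖φ z‖ₑ := by
  obtain ⟨C₁, h₁⟩ := exists_lintegral_parabola_rpow_le hε hq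
  obtain ⟨C₂, h₂⟩ := exists_lintegral_abs_sub_rpow_le (r := ε / 4 - 1) (by linarith)
  set r := q / 2 with hr
  have hr2 : 2 ≤ r := by rw [hr, hq]; linarith
  refine ⟨C₁ * (2 ^ (r - 2) * (2 ^ (r - 2) * 2)) * C₂, fun φ hφ hφ1 hsupp => ?_⟩
  set F := partialFourier φ with hF
  have hFm : Measurable (Function.uncurry F) := measurable_partialFourier hφ
  set h : ℝ → ℝ≥0∞ := fun s => ∫⁻ w, ‖φ (s, w)‖ₑ with hh
  have hhm : Measurable h := by
    exact Measurable.lintegral_prod_right' (f := fun z => ‖φ z‖ₑ) (by fun_prop)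
  have hgm : ∀ c : ℝ × ℝ, Measurable fun s => F s (c.1 + s * c.2) := fun c =>
    hFm.comp (f := fun s => (s, c.1 + s * c.2)) (by fun_prop)
  have hjoint : Measurable fun p : (ℝ × ℝ) × (ℝ × ℝ) =>
      ‖F p.2.1 (p.1.1 + p.2.1 * p.1.2)‖ₑ ^ r * ‖F p.2.2 (p.1.1 + p.2.2 * p.1.2)‖ₑ ^ r *
        ENNReal.ofReal |p.2.1 - p.2.2| ^ (ε / 4) := by
    have m1 : Measurable fun p : (ℝ × ℝ) × (ℝ × ℝ) => F p.2.1 (p.1.1 + p.2.1 * p.1.2) :=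
      hFm.comp (f := fun p : (ℝ × ℝ) × (ℝ × ℝ) => (p.2.1, p.1.1 + p.2.1 * p.1.2)) (by fun_prop)
    have m2 : Measurable fun p : (ℝ × ℝ) × (ℝ × ℝ) => F p.2.2 (p.1.1 + p.2.2 * p.1.2) :=
      hFm.comp (f := fun p : (ℝ × ℝ) × (ℝ × ℝ) => (p.2.2, p.1.1 + p.2.2 * p.1.2)) (by fun_prop)
    fun_prop
  have hdiag : ∀ᵐ ω ∂(intervalMeasure.prod intervalMeasure), ω.2 ≠ ω.1 := by
    rw [Measure.ae_prod_iff_ae_ae]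
    · exact Filter.Eventually.of_forall fun s => ae_intervalMeasure_ne s
    · exact (measurableSet_eq_fun measurable_snd measurable_fst).compl
  calc _ ≤ ∫⁻ c : ℝ × ℝ, C₁ * ∫⁻ ω : ℝ × ℝ, ‖F ω.1 (c.1 + ω.1 * c.2)‖ₑ ^ r *
          ‖F ω.2 (c.1 + ω.2 * c.2)‖ₑ ^ r * ENNReal.ofReal |ω.1 - ω.2| ^ (ε / 4)
          ∂(intervalMeasure.prod intervalMeasure) := by
        refine lintegral_mono fun c => h₁ _ (hgm c) ?_ ?_
        · refine ⟨(hgm c).aestronglyMeasurable, ?_⟩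
          refine lt_of_le_of_lt (b := ∫⁻ s, (Set.Icc (-1 : ℝ) 1).indicator (fun _ => (2 : ℝ≥0∞)) s)
            (lintegral_mono fun s => ?_) ?_
          · by_cases hs : s ∈ Set.Icc (-1 : ℝ) 1
            · rw [Set.indicator_of_mem hs]; exact enorm_partialFourier_le hφ1 hsupp _ _
            · have : F s (c.1 + s * c.2) = 0 := partialFourier_eq_zero hsupp hs _
              simp [this]
          · rw [lintegral_indicator measurableSet_Icc]
            simp [ENNReal.mul_lt_top_iff]
        · intro s hs
          exact partialFourier_eq_zero hsupp hs _
    _ = C₁ * ∫⁻ ω : ℝ × ℝ, (∫⁻ c : ℝ × ℝ, ‖F ω.1 (c.1 + ω.1 * c.2)‖ₑ ^ r *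
          ‖F ω.2 (c.1 + ω.2 * c.2)‖ₑ ^ r * ENNReal.ofReal |ω.1 - ω.2| ^ (ε / 4))
          ∂(intervalMeasure.prod intervalMeasure) := by
        rw [lintegral_const_mul _ (Measurable.lintegral_prod_right' hjoint),
          lintegral_lintegral_swap hjoint.aemeasurable]
    _ ≤ C₁ * ∫⁻ ω : ℝ × ℝ, (2 ^ (r - 2) * (2 ^ (r - 2) * 2)) *
          (h ω.1 * ENNReal.ofReal |ω.1 - ω.2| ^ (ε / 4 - 1))
          ∂(intervalMeasure.prod intervalMeasure) := by
        refine mul_le_mul_right (lintegral_mono_ae ?_) _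
        filter_upwards [hdiag] with ω hω
        have hF1 : ∀ s, Measurable (F s) := fun s => hFm.comp measurable_prodMk_left
        have hD : 0 < |ω.1 - ω.2| := abs_pos.2 (sub_ne_zero.2 (Ne.symm hω))
        have hb : ∀ s, ∫⁻ y, ‖F s y‖ₑ ^ r ≤ 2 ^ (r - 2) * h s := fun s =>
          lintegral_partialFourier_rpow_le hφ hφ1 hsupp hr2 s
        have hb2 : ∫⁻ y, ‖F ω.2 y‖ₑ ^ r ≤ 2 ^ (r - 2) * 2 :=
          (hb _).trans (by gcongr; exact lintegral_slice_le_two hφ1 hsupp _)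
        have hF1' := hF1 ω.1
        have hF2' := hF1 ω.2
        rw [lintegral_mul_const _ (by fun_prop),
          lintegral_lines (P := fun y => ‖F ω.1 y‖ₑ ^ r) (Q := fun y => ‖F ω.2 y‖ₑ ^ r)
            (by fun_prop) (by fun_prop) hω]
        have eD : ENNReal.ofReal |ω.1 - ω.2| ^ (ε / 4 - 1) =
            ENNReal.ofReal |ω.1 - ω.2| ^ (ε / 4) * ENNReal.ofReal |ω.1 - ω.2|⁻¹ := by
          rw [sub_eq_add_neg (ε / 4), ENNReal.rpow_add _ _ (by simpa using hD) (by simp),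
            ENNReal.rpow_neg_one,
            ENNReal.ofReal_inv_of_pos hD]
        rw [eD]
        calc _ ≤ ENNReal.ofReal |ω.1 - ω.2|⁻¹ * ((2 ^ (r - 2) * h ω.1) * (2 ^ (r - 2) * 2)) *
              ENNReal.ofReal |ω.1 - ω.2| ^ (ε / 4) := by
              gcongr
              exact hb _
          _ = _ := by ring
    _ = C₁ * ((2 ^ (r - 2) * (2 ^ (r - 2) * 2)) * ∫⁻ ω : ℝ × ℝ,
          (h ω.1 * ENNReal.ofReal |ω.1 - ω.2| ^ (ε / 4 - 1))
          ∂(intervalMeasure.prod intervalMeasure)) := by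
        rw [lintegral_const_mul _ (by fun_prop)]
    _ ≤ C₁ * ((2 ^ (r - 2) * (2 ^ (r - 2) * 2)) * (C₂ * ∫⁻ z, ‖φ z‖ₑ)) := by
        refine mul_le_mul_right (mul_le_mul_right ?_ _) _
        refine (lintegral_prod_le_of_kernel_le (by fun_prop) h₂ hhm).trans ?_
        gcongr
        rw [Measure.volume_eq_prod, lintegral_prod _ (by fun_prop)]
        exact setLIntegral_le_lintegral _ _
    _ = _ := by
        push_cast
        rw [ENNReal.coe_rpow_of_nonneg _ (by linarith)]
        push_cast
        ring

/-! ### Passage to ℝ⁴ and the restricted estimate -/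

/-- Splitting of the coordinates of `ℝ⁴` into `(x₁, x₃)` and `(x₀, x₂)`. -/
theorem measurePreserving_fin_four :
    MeasurePreserving (fun p : (ℝ × ℝ) × (ℝ × ℝ) => (![p.2.1, p.1.1, p.2.2, p.1.2] : Fin 4 → ℝ)) := by
  have hm : Measurable (fun p : (ℝ × ℝ) × (ℝ × ℝ) =>
      (![p.2.1, p.1.1, p.2.2, p.1.2] : Fin 4 → ℝ)) := by
    refine measurable_pi_lambda _ fun i => ?_
    fin_cases i <;> simp <;> fun_prop
  refine ⟨hm, ?_⟩
  refine (Measure.pi_eq fun s hs => ?_).symm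
  rw [Measure.map_apply hm (MeasurableSet.univ_pi hs)]
  have : (fun p : (ℝ × ℝ) × (ℝ × ℝ) => (![p.2.1, p.1.1, p.2.2, p.1.2] : Fin 4 → ℝ)) ⁻¹'
      (Set.univ.pi s) = (s 1 ×ˢ s 3) ×ˢ (s 0 ×ˢ s 2) := by
    ext p
    simp [Fin.forall_fin_succ]
    tauto
  rw [this, Measure.volume_eq_prod, Measure.prod_prod, Measure.volume_eq_prod, Measure.prod_prod,
    Measure.prod_prod, Fin.prod_univ_four]
  ring

theorem lintegral_fin_four {Φ : (Fin 4 → ℝ) → ℝ≥0∞} (hΦ : Measurable Φ) :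
    ∫⁻ x, Φ x = ∫⁻ c : ℝ × ℝ, ∫⁻ y : ℝ × ℝ, Φ ![y.1, c.1, y.2, c.2] := by
  rw [← measurePreserving_fin_four.lintegral_comp hΦ, Measure.volume_eq_prod, lintegral_prod]
  exact (hΦ.comp measurePreserving_fin_four.measurable).aemeasurable

theorem extS6_eq_integral_indicator (f : (Fin 2 → ℝ) → ℂ) (x : Fin 4 → ℝ) :
    extS6 f x = ∫ z : ℝ × ℝ, (Set.Icc (-1 : Fin 2 → ℝ) 1).indicator f ![z.1, z.2] *
      chi (phaseS6 x ![z.1, z.2]) := by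
  have h1 : extS6 f x = ∫ ξ : Fin 2 → ℝ, (Set.Icc (-1 : Fin 2 → ℝ) 1).indicator f ξ *
      chi (phaseS6 x ξ) := by
    rw [extS6, ← integral_indicator measurableSet_Icc]
    congr 1; ext ξ
    by_cases hξ : ξ ∈ Set.Icc (-1 : Fin 2 → ℝ) 1 <;> simp [hξ, chi]
  rw [h1, ← (volume_preserving_finTwoArrow ℝ).symm.integral_comp
    (MeasurableEquiv.finTwoArrow (α := ℝ)).symm.measurableEmbedding]
  rfl

theorem measurable_vec_two : Measurable fun z : ℝ × ℝ => (![z.1, z.2] : Fin 2 → ℝ) :=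
  (MeasurableEquiv.finTwoArrow (α := ℝ)).symm.measurable

theorem measurable_phaseS6 : Measurable fun p : (Fin 4 → ℝ) × (Fin 2 → ℝ) => phaseS6 p.1 p.2 := by
  unfold phaseS6; fun_prop

theorem mem_Icc_vec_two {z : ℝ × ℝ} :
    (![z.1, z.2] : Fin 2 → ℝ) ∈ Set.Icc (-1 : Fin 2 → ℝ) 1 ↔
      z ∈ Set.Icc (-1 : ℝ) 1 ×ˢ Set.Icc (-1 : ℝ) 1 := by
  rw [Set.mem_prod]
  simp only [Set.mem_Icc, Pi.le_def, Fin.forall_fin_two]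
  simp
  tauto

theorem measurable_extS6 {f : (Fin 2 → ℝ) → ℂ} (hf : Measurable f) : Measurable (extS6 f) := by
  refine (StronglyMeasurable.integral_prod_right (Measurable.stronglyMeasurable ?_)).measurable
  have := measurable_phaseS6
  simp only [Function.uncurry_def]
  fun_prop

/-- Fubini with w innermost, the phase being grouped as w (b + s d) + (s a + s² c). -/
theorem extS6_eq_integral_partialFourier {f : (Fin 2 → ℝ) → ℂ}
    (hi : Integrable fun z : ℝ × ℝ => (Set.Icc (-1 : Fin 2 → ℝ) 1).indicator f ![z.1, z.2])
    (a b c d : ℝ) :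
    extS6 f ![a, b, c, d] = ∫ s, partialFourier
      (fun z : ℝ × ℝ => (Set.Icc (-1 : Fin 2 → ℝ) 1).indicator f ![z.1, z.2]) s (b + s * d) *
        chi (s * a + s ^ 2 * c) := by
  rw [extS6_eq_integral_indicator, Measure.volume_eq_prod, integral_prod]
  · congr 1; ext s
    rw [partialFourier, ← integral_mul_const]
    congr 1; ext w
    rw [mul_assoc, ← chi_add]
    congr 2
    simp [phaseS6]
    ring
  · refine integrable_mul_chi hi ?_
    unfold phaseS6
    simp
    fun_prop

/-- The restricted estimate: for `q > 5` and `|f| ≤ 1` one has `‖E f‖_q^q ≤ C ‖f‖₁`. -/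
theorem exists_lintegral_extS6_rpow_le {ε q : ℝ} (hε : 0 < ε) (hq : q = 5 + 2 * ε) :
    ∃ C : ℝ≥0, ∀ f : (Fin 2 → ℝ) → ℂ, Measurable f → (∀ ξ, ‖f ξ‖ₑ ≤ 1) →
      ∫⁻ x, ‖extS6 f x‖ₑ ^ q ≤ C * ∫⁻ ξ in Set.Icc (-1 : Fin 2 → ℝ) 1, ‖f ξ‖ₑ := by
  obtain ⟨C, hC⟩ := exists_lintegral_fibered_parabola_le hε hq
  refine ⟨C, fun f hf hf1 => ?_⟩
  set φ : ℝ × ℝ → ℂ := fun z => (Set.Icc (-1 : Fin 2 → ℝ) 1).indicator f ![z.1, z.2] with hφ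
  have hφm : Measurable φ := (hf.indicator measurableSet_Icc).comp measurable_vec_two
  have hφ1 : ∀ z, ‖φ z‖ₑ ≤ 1 := fun z => by
    simp only [hφ]
    by_cases hz : (![z.1, z.2] : Fin 2 → ℝ) ∈ Set.Icc (-1 : Fin 2 → ℝ) 1
    · rw [Set.indicator_of_mem hz]; exact hf1 _
    · rw [Set.indicator_of_notMem hz]; simp
  have hsupp : ∀ z ∉ Set.Icc (-1 : ℝ) 1 ×ˢ Set.Icc (-1 : ℝ) 1, φ z = 0 := fun z hz =>
    Set.indicator_of_notMem (fun h => hz (mem_Icc_vec_two.1 h)) _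
  have hnorm : ∫⁻ z, ‖φ z‖ₑ = ∫⁻ ξ in Set.Icc (-1 : Fin 2 → ℝ) 1, ‖f ξ‖ₑ := by
    rw [← lintegral_indicator measurableSet_Icc,
      ← (volume_preserving_finTwoArrow ℝ).symm.lintegral_comp_emb
        (MeasurableEquiv.finTwoArrow (α := ℝ)).symm.measurableEmbedding]
    congr 1; ext z
    simp only [hφ]
    by_cases hz : (![z.1, z.2] : Fin 2 → ℝ) ∈ Set.Icc (-1 : Fin 2 → ℝ) 1
    · rw [Set.indicator_of_mem hz]; exact (Set.indicator_of_mem hz (fun ξ => ‖f ξ‖ₑ)).symm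
    · rw [Set.indicator_of_notMem hz, enorm_zero]; exact (Set.indicator_of_notMem hz (fun ξ => ‖f ξ‖ₑ)).symm
  have hφi : Integrable φ := by
    refine ⟨hφm.aestronglyMeasurable, ?_⟩
    rw [HasFiniteIntegral, hnorm]
    calc _ ≤ ∫⁻ ξ in Set.Icc (-1 : Fin 2 → ℝ) 1, 1 := lintegral_mono fun ξ => hf1 ξ
      _ < ∞ := by simpa using isCompact_Icc.measure_lt_top
  have := hC φ hφm hφ1 hsupp
  rw [← hnorm, lintegral_fin_four (by have := measurable_extS6 hf; fun_prop)]
  simp_rw [extS6_eq_integral_partialFourier hφi]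
  exact this

/-! ### From the restricted estimate to the open range -/

/-- The square `[-1, 1]²`. -/
abbrev unitSquare : Set (Fin 2 → ℝ) := Set.Icc (-1 : Fin 2 → ℝ) 1

theorem volume_unitSquare_lt_top : volume unitSquare < ∞ := isCompact_Icc.measure_lt_top

theorem volume_unitSquare : volume unitSquare = 4 := by
  rw [Real.volume_Icc_pi]
  simp
  norm_num

theorem extS6_congr_ae {f g : (Fin 2 → ℝ) → ℂ} (h : f =ᵐ[volume] g) : extS6 f = extS6 g := by
  ext x
  unfold extS6
  refine integral_congr_ae (ae_restrict_of_ae ?_)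
  filter_upwards [h] with ξ hξ
  rw [hξ]

theorem extS6_const_smul (c : ℂ) (f : (Fin 2 → ℝ) → ℂ) : extS6 (c • f) = c • extS6 f := by
  ext x
  simp only [extS6, Pi.smul_apply, smul_eq_mul, mul_assoc]
  rw [integral_const_mul]

theorem extS6_eq_integral_chi (f : (Fin 2 → ℝ) → ℂ) (x : Fin 4 → ℝ) :
    extS6 f x = ∫ ξ in unitSquare, f ξ * chi (phaseS6 x ξ) := rfl

theorem measurable_phaseS6_right (x : Fin 4 → ℝ) : Measurable (phaseS6 x) := by
  unfold phaseS6; fun_prop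

theorem extS6_add {f g : (Fin 2 → ℝ) → ℂ} (hf : IntegrableOn f unitSquare)
    (hg : IntegrableOn g unitSquare) : extS6 (f + g) = extS6 f + extS6 g := by
  ext x
  simp only [extS6_eq_integral_chi, Pi.add_apply, add_mul]
  exact integral_add (integrable_mul_chi hf (measurable_phaseS6_right x))
    (integrable_mul_chi hg (measurable_phaseS6_right x))

theorem extS6_indicator (f : (Fin 2 → ℝ) → ℂ) : extS6 (unitSquare.indicator f) = extS6 f := by
  ext x
  rw [extS6_eq_integral_chi, extS6_eq_integral_chi]
  refine setIntegral_congr_fun measurableSet_Icc fun ξ hξ => ?_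
  rw [Set.indicator_of_mem hξ]

theorem enorm_extS6_le (f : (Fin 2 → ℝ) → ℂ) (x : Fin 4 → ℝ) :
    ‖extS6 f x‖ₑ ≤ ∫⁻ ξ in unitSquare, ‖f ξ‖ₑ := by
  rw [extS6_eq_integral_chi]
  refine (enorm_integral_le_lintegral_enorm _).trans (le_of_eq ?_)
  simp

/-- Apply the restricted estimate to f/M at q₀ = 5 + 2ε and absorb the remaining power q - q₀ with
|E f| ≤ J, where J is the L¹ norm on the square. This leaves M^(q₀ - 1) J^(q - q₀ + 1) before taking
q-th roots. -/
theorem exists_eLpNorm_extS6_le_of_bounded {q ε : ℝ} (hε : 0 < ε) (hq : 5 + 2 * ε ≤ q) :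
    ∃ C : ℝ≥0, ∀ (M : ℝ≥0) (f : (Fin 2 → ℝ) → ℂ), M ≠ 0 → Measurable f → (∀ ξ, ‖f ξ‖ₑ ≤ M) →
      eLpNorm (extS6 f) (ENNReal.ofReal q) volume ≤
        C * (M : ℝ≥0∞) ^ ((4 + 2 * ε) / q) *
          (∫⁻ ξ in unitSquare, ‖f ξ‖ₑ) ^ ((q - 4 - 2 * ε) / q) := by
  obtain ⟨C, hC⟩ := exists_lintegral_extS6_rpow_le hε (q := 5 + 2 * ε) rfl
  have hq0 : 0 < q := by linarith
  refine ⟨C ^ (1 / q), fun M f hM hf hfM => ?_⟩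
  set q₀ := 5 + 2 * ε with hq₀
  set J := ∫⁻ ξ in unitSquare, ‖f ξ‖ₑ with hJ
  have hMe0 : (M : ℝ≥0∞) ≠ 0 := by simpa using hM
  have hMc : ‖(M : ℂ)‖ₑ = M := by
    rw [← ofReal_norm]; simp
  set g : (Fin 2 → ℝ) → ℂ := ((M : ℂ)⁻¹) • f with hg
  have hMC : (M : ℂ) ≠ 0 := by exact_mod_cast hM
  have hMci : ‖(M : ℂ)⁻¹‖ₑ = (M : ℝ≥0∞)⁻¹ := by rw [enorm_inv hMC, hMc]
  have hgn : ∀ ξ, ‖g ξ‖ₑ = (M : ℝ≥0∞)⁻¹ * ‖f ξ‖ₑ := fun ξ => by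
    simp only [hg, Pi.smul_apply, smul_eq_mul, enorm_mul, hMci]
  have hg1 : ∀ ξ, ‖g ξ‖ₑ ≤ 1 := fun ξ => by
    rw [hgn, mul_comm, ← div_eq_mul_inv]
    exact ENNReal.div_le_of_le_mul (by simpa using hfM ξ)
  have hfg : f = (M : ℂ) • g := by
    rw [hg, smul_smul, mul_inv_cancel₀ hMC, one_smul]
  have hgm : Measurable g := hf.const_smul _
  have hEg := hC g hgm hg1
  have hJg : ∫⁻ ξ in unitSquare, ‖g ξ‖ₑ = (M : ℝ≥0∞)⁻¹ * J := by
    simp_rw [hgn]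
    rw [lintegral_const_mul _ (by fun_prop)]
  have hEf : ∀ x, ‖extS6 f x‖ₑ = M * ‖extS6 g x‖ₑ := fun x => by
    rw [hfg, extS6_const_smul, Pi.smul_apply, smul_eq_mul, enorm_mul, hMc]
  have hmain : ∫⁻ x, ‖extS6 f x‖ₑ ^ q ≤
      C * ((M : ℝ≥0∞) ^ (4 + 2 * ε) * J ^ (q - 4 - 2 * ε)) := by
    have hm := measurable_extS6 hgm
    calc _ ≤ ∫⁻ x, J ^ (q - q₀) * ((M : ℝ≥0∞) ^ q₀ * ‖extS6 g x‖ₑ ^ q₀) := by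
          refine lintegral_mono fun x => ?_
          simp only
          rw [← ENNReal.mul_rpow_of_nonneg _ _ (by positivity), ← hEf]
          calc _ = ‖extS6 f x‖ₑ ^ (q - q₀) * ‖extS6 f x‖ₑ ^ q₀ := by
                rw [← ENNReal.rpow_add_of_nonneg _ _ (by linarith) (by positivity), sub_add_cancel]
            _ ≤ _ := by
                gcongr
                exact enorm_extS6_le f x
      _ = J ^ (q - q₀) * ((M : ℝ≥0∞) ^ q₀ * ∫⁻ x, ‖extS6 g x‖ₑ ^ q₀) := by
          rw [lintegral_const_mul _ (by fun_prop), lintegral_const_mul _ (by fun_prop)]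
      _ ≤ J ^ (q - q₀) * ((M : ℝ≥0∞) ^ q₀ * (C * ((M : ℝ≥0∞)⁻¹ * J))) := by
          rw [← hJg]; gcongr
      _ = C * (((M : ℝ≥0∞) ^ q₀ * (M : ℝ≥0∞)⁻¹) * (J ^ (q - q₀) * J)) := by ring
      _ = _ := by
          congr 2
          · rw [← ENNReal.rpow_neg_one, ← ENNReal.rpow_add _ _ hMe0 (by simp)]
            congr 1; rw [hq₀]; ring
          · nth_rw 2 [← ENNReal.rpow_one J]
            rw [← ENNReal.rpow_add_of_nonneg _ _ (by linarith) (by norm_num)]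
            congr 1; rw [hq₀]; ring
  rw [eLpNorm_eq_lintegral_rpow_enorm_toReal (by simpa using hq0) (by simp),
    ENNReal.toReal_ofReal hq0.le]
  refine (ENNReal.rpow_le_rpow hmain (by positivity)).trans (le_of_eq ?_)
  rw [ENNReal.mul_rpow_of_nonneg _ _ (by positivity), ENNReal.mul_rpow_of_nonneg _ _ (by positivity),
    ← ENNReal.rpow_mul, ← ENNReal.rpow_mul, ENNReal.coe_rpow_of_nonneg _ (by positivity), mul_assoc,
    mul_one_div, mul_one_div]

/-- On `S` one has |f| ≤ m^(-(p-1)) |f|^p. -/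
theorem lintegral_enorm_level_le {p : ℝ} (hp : 1 < p) {f : (Fin 2 → ℝ) → ℂ} (hf : Measurable f)
    {m : ℝ≥0} (hm : m ≠ 0) {S : Set (Fin 2 → ℝ)}
    (hS : ∀ ξ ∈ S, (m : ℝ≥0∞) ≤ ‖f ξ‖ₑ) (hfp : ∫⁻ ξ, ‖f ξ‖ₑ ^ p ≤ 1) :
    ∫⁻ ξ in unitSquare, ‖S.indicator f ξ‖ₑ ≤ (m : ℝ≥0∞) ^ (-(p - 1)) := by
  have hm0 : (m : ℝ≥0∞) ≠ 0 := by simpa using hm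
  calc _ ≤ ∫⁻ ξ in unitSquare, (m : ℝ≥0∞) ^ (-(p - 1)) * ‖f ξ‖ₑ ^ p := by
        refine lintegral_mono fun ξ => ?_
        by_cases hξ : ξ ∈ S
        · rw [Set.indicator_of_mem hξ]
          calc ‖f ξ‖ₑ = ((m : ℝ≥0∞) ^ (-(p - 1)) * (m : ℝ≥0∞) ^ (p - 1)) * ‖f ξ‖ₑ := by
                rw [← ENNReal.rpow_add _ _ hm0 (by simp), neg_add_cancel, ENNReal.rpow_zero, one_mul]
            _ ≤ ((m : ℝ≥0∞) ^ (-(p - 1)) * ‖f ξ‖ₑ ^ (p - 1)) * ‖f ξ‖ₑ := by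
                gcongr
                exact hS ξ hξ
            _ = (m : ℝ≥0∞) ^ (-(p - 1)) * (‖f ξ‖ₑ ^ (p - 1) * ‖f ξ‖ₑ ^ (1 : ℝ)) := by
                rw [ENNReal.rpow_one, mul_assoc]
            _ = _ := by
                rw [← ENNReal.rpow_add_of_nonneg _ _ (by linarith) zero_le_one, sub_add_cancel]
        · rw [Set.indicator_of_notMem hξ]; simp
    _ ≤ ∫⁻ ξ, (m : ℝ≥0∞) ^ (-(p - 1)) * ‖f ξ‖ₑ ^ p := setLIntegral_le_lintegral _ _
    _ = (m : ℝ≥0∞) ^ (-(p - 1)) * ∫⁻ ξ, ‖f ξ‖ₑ ^ p := lintegral_const_mul _ (by fun_prop)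
    _ ≤ (m : ℝ≥0∞) ^ (-(p - 1)) * 1 := by gcongr
    _ = _ := mul_one _

theorem exists_eLpNorm_extS6_le_of_normalized {p q : ℝ} (hp : 1 < p) (hq : 5 < q)
    (hpq : 1 / p + 4 / q < 1) :
    ∃ C : ℝ≥0, ∀ f : (Fin 2 → ℝ) → ℂ, Measurable f → ∫⁻ ξ, ‖f ξ‖ₑ ^ p ≤ 1 →
      IntegrableOn f unitSquare → eLpNorm (extS6 f) (ENNReal.ofReal q) volume ≤ C := by
  have hq0 : 0 < q := by linarith
  have hp0 : 0 < p := by linarith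
  -- The last condition says 2ε < q(1 - 1/p - 4/q), so the two strict hypotheses leave room for a
  -- positive ε.
  obtain ⟨ε, hε, hεq, hεp⟩ : ∃ ε : ℝ, 0 < ε ∧ 5 + 2 * ε ≤ q ∧ 1 / p < (q - 4 - 2 * ε) / q := by
    have hδ : 0 < q * (1 - (1 / p + 4 / q)) := mul_pos hq0 (by linarith)
    refine ⟨min ((q - 5) / 2) (q * (1 - (1 / p + 4 / q)) / 4), lt_min (by linarith) (by linarith),
      by linarith [min_le_left ((q - 5) / 2) (q * (1 - (1 / p + 4 / q)) / 4)], ?_⟩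
    rw [lt_div_iff₀ hq0]
    have h1 := min_le_right ((q - 5) / 2) (q * (1 - (1 / p + 4 / q)) / 4)
    have h2 : q * (1 - (1 / p + 4 / q)) = q - 1 / p * q - 4 := by field_simp; ring
    rw [h2] at h1 hδ ⊢
    linarith
  obtain ⟨C, hC⟩ := exists_eLpNorm_extS6_le_of_bounded hε hεq
  set β := (q - 4 - 2 * ε) / q with hβ
  have hβ0 : 0 < β := lt_trans (by positivity) hεp
  have hβ1 : (4 + 2 * ε) / q = 1 - β := by rw [hβ]; field_simp; ring
  rw [hβ1] at hC
  -- Decay rate of the dyadic pieces: the level |f| ~ 2^n has sup at most 2^(n+1) and L¹ norm at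
  -- most 2^(-n(p-1)). It contributes 2^((n+1)(1-β)) 2^(-n(p-1)β) = 2^(1-β) 2^(-nθ).
  set θ := β * p - 1 with hθ
  have hθ0 : 0 < θ := by
    rw [div_lt_iff₀ hp0] at hεp; rw [hθ]; linarith
  set a : ℕ → ℝ≥0 := fun k => C * 2 ^ (1 - β) * (2 ^ (-θ)) ^ k with ha
  have hr1 : (2 : ℝ≥0) ^ (-θ) < 1 :=
    NNReal.rpow_lt_one_of_one_lt_of_neg (by norm_num) (by linarith)
  have hsum : Summable a := (NNReal.summable_geometric hr1).mul_left _
  refine ⟨C * 4 ^ β + ∑' k, a k, fun f hf hfp hfi => ?_⟩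
  set S : ℕ → Set (Fin 2 → ℝ) := fun n => {ξ | ‖f ξ‖ₑ ≤ ((2 ^ n : ℝ≥0) : ℝ≥0∞)} with hS
  have hSm : ∀ n, MeasurableSet (S n) := fun n => measurableSet_le (by fun_prop) (by fun_prop)
  have hSmono : Monotone S := by
    intro m n hmn ξ hξ
    refine le_trans (show ‖f ξ‖ₑ ≤ _ from hξ) ?_
    exact_mod_cast pow_le_pow_right₀ (by norm_num) hmn
  set T : ℕ → (Fin 2 → ℝ) → ℂ := fun n => (S n).indicator f with hT
  have hTm : ∀ n, Measurable (T n) := fun n => hf.indicator (hSm n)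
  have hTi : ∀ n, IntegrableOn (T n) unitSquare := fun n => hfi.indicator (hSm n)
  have hq1 : 1 ≤ ENNReal.ofReal q := by
    rw [← ENNReal.ofReal_one]; exact ENNReal.ofReal_le_ofReal (by linarith)
  have hbase : eLpNorm (extS6 (T 0)) (ENNReal.ofReal q) volume ≤ (C * 4 ^ β : ℝ≥0) := by
    have hT1 : ∀ ξ, ‖T 0 ξ‖ₑ ≤ (1 : ℝ≥0) := fun ξ => by
      by_cases hξ : ξ ∈ S 0
      · simp only [hT, Set.indicator_of_mem hξ]
        simpa [hS] using hξ
      · simp only [hT, Set.indicator_of_notMem hξ]; simp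
    refine (hC 1 (T 0) one_ne_zero (hTm 0) hT1).trans ?_
    have : ∫⁻ ξ in unitSquare, ‖T 0 ξ‖ₑ ≤ 4 := by
      calc _ ≤ ∫⁻ ξ in unitSquare, 1 := lintegral_mono fun ξ => by simpa using hT1 ξ
        _ = 4 := by simp [volume_unitSquare]
    calc _ ≤ (C : ℝ≥0∞) * ((1 : ℝ≥0) : ℝ≥0∞) ^ (1 - β) * 4 ^ β := by gcongr
      _ = _ := by
        rw [ENNReal.coe_one, ENNReal.one_rpow, mul_one, ENNReal.coe_mul,
          ENNReal.coe_rpow_of_nonneg _ hβ0.le]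
        simp
  have hstep : ∀ n, eLpNorm (extS6 ((S (n + 1) \ S n).indicator f)) (ENNReal.ofReal q) volume ≤
      a n := by
    intro n
    have hDm : MeasurableSet (S (n + 1) \ S n) := (hSm _).diff (hSm _)
    have hb : ∀ ξ, ‖(S (n + 1) \ S n).indicator f ξ‖ₑ ≤ ((2 ^ (n + 1) : ℝ≥0) : ℝ≥0∞) := fun ξ => by
      by_cases hξ : ξ ∈ S (n + 1) \ S n
      · rw [Set.indicator_of_mem hξ]; exact hξ.1
      · rw [Set.indicator_of_notMem hξ]; simp
    have hJ := lintegral_enorm_level_le hp hf (m := 2 ^ n) (S := S (n + 1) \ S n) (by positivity)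
      (fun ξ hξ => le_of_lt (not_le.1 hξ.2)) hfp
    refine (hC (2 ^ (n + 1)) _ (by positivity) (hf.indicator hDm) hb).trans ?_
    calc _ ≤ (C : ℝ≥0∞) * ((2 ^ (n + 1) : ℝ≥0) : ℝ≥0∞) ^ (1 - β) *
          ((((2 ^ n : ℝ≥0) : ℝ≥0∞)) ^ (-(p - 1))) ^ β := by gcongr
      _ = ((C * (2 ^ (n + 1)) ^ (1 - β) * (((2 ^ n) ^ (-(p - 1))) ^ β) : ℝ≥0) : ℝ≥0∞) := by
        rw [ENNReal.coe_mul, ENNReal.coe_mul, ENNReal.coe_rpow_of_ne_zero (by positivity),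
          ENNReal.coe_rpow_of_ne_zero (by positivity), ENNReal.coe_rpow_of_ne_zero (by positivity)]
      _ = a n := by
        congr 1
        rw [ha]
        simp only
        rw [← NNReal.rpow_natCast, ← NNReal.rpow_natCast, ← NNReal.rpow_natCast, ← NNReal.rpow_mul,
          ← NNReal.rpow_mul, ← NNReal.rpow_mul, ← NNReal.rpow_mul, mul_assoc, mul_assoc,
          ← NNReal.rpow_add (by norm_num), ← NNReal.rpow_add (by norm_num)]
        congr 2
        push_cast
        rw [hθ]; ring
  have hTbound : ∀ n, eLpNorm (extS6 (T n)) (ENNReal.ofReal q) volume ≤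
      ((C * 4 ^ β + ∑ k ∈ Finset.range n, a k : ℝ≥0) : ℝ≥0∞) := by
    intro n
    induction n with
    | zero => simpa using hbase
    | succ n ih =>
      have hDm : MeasurableSet (S (n + 1) \ S n) := (hSm _).diff (hSm _)
      have hdec : T (n + 1) = T n + (S (n + 1) \ S n).indicator f := by
        have hu : S n ∪ (S (n + 1) \ S n) = S (n + 1) :=
          Set.union_sdiff_cancel (hSmono (Nat.le_succ n))
        simp only [hT]
        rw [← hu, Set.indicator_union_of_disjoint Set.disjoint_sdiff_right, hu]
        rfl
      rw [hdec, extS6_add (hTi n) (hfi.indicator hDm), Finset.sum_range_succ, ← add_assoc,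
        ENNReal.coe_add]
      refine (eLpNorm_add_le (measurable_extS6 (hTm n)).aestronglyMeasurable
        (measurable_extS6 (hf.indicator hDm)).aestronglyMeasurable hq1).trans ?_
      exact add_le_add ih (hstep n)
  have hlim : ∀ x, Filter.Tendsto (fun n => extS6 (T n) x) Filter.atTop (nhds (extS6 f x)) := by
    intro x
    simp only [extS6_eq_integral_chi]
    refine tendsto_integral_of_dominated_convergence (fun ξ => ‖f ξ‖) (fun n => ?_) hfi.norm
      (fun n => Filter.Eventually.of_forall fun ξ => ?_) (Filter.Eventually.of_forall fun ξ => ?_)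
    · have := measurable_phaseS6_right x
      have := hTm n
      exact Measurable.aestronglyMeasurable (by fun_prop)
    · rw [norm_mul, norm_chi, mul_one]
      exact norm_indicator_le_norm_self _ _
    · refine Filter.Tendsto.mul_const _ ?_
      obtain ⟨n₀, hn₀⟩ := pow_unbounded_of_one_lt ‖f ξ‖ (show (1 : ℝ) < 2 by norm_num)
      refine tendsto_const_nhds.congr' ?_
      filter_upwards [Filter.eventually_ge_atTop n₀] with n hn
      have : ξ ∈ S n := by
        refine hSmono hn ?_
        simp only [hS, Set.mem_ofPred_eq]
        rw [← ofReal_norm, ENNReal.ofReal_le_iff_le_toReal (by simp)]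
        simpa using hn₀.le
      simp only [hT]
      rw [Set.indicator_of_mem this]
  -- Fatou: the truncations have uniformly bounded norms and their extensions converge pointwise.
  refine (Lp.eLpNorm_lim_le_liminf_eLpNorm (fun n => (measurable_extS6 (hTm n)).aestronglyMeasurable)
    _ (Filter.Eventually.of_forall hlim)).trans ?_
  refine Filter.liminf_le_of_le (by isBoundedDefault) fun b hb => ?_
  obtain ⟨n, hn⟩ := hb.exists
  refine hn.trans ((hTbound n).trans ?_)
  exact_mod_cast add_le_add le_rfl (hsum.sum_le_tsum _ fun _ _ => zero_le)

theorem eLpNorm_extS6_smul_le {p q : ℝ≥0∞} {C : ℝ≥0} (hp0 : p ≠ 0)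
    (h : ∀ f : (Fin 2 → ℝ) → ℂ, Measurable f → MemLp f p volume → eLpNorm f p volume ≤ 1 →
      eLpNorm (extS6 f) q volume ≤ C) {f : (Fin 2 → ℝ) → ℂ} (hf : MemLp f p volume) :
    eLpNorm (extS6 f) q volume ≤ C * eLpNorm f p volume := by
  wlog hfm : Measurable f generalizing f
  · obtain ⟨g, hg, hae⟩ := hf.1
    have := this (hf.ae_eq hae) hg.measurable
    rwa [← extS6_congr_ae hae, ← eLpNorm_congr_ae hae] at this
  by_cases h0 : eLpNorm f p volume = 0
  · have : f =ᵐ[volume] 0 := (eLpNorm_eq_zero_iff hf.1 hp0).1 h0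
    rw [extS6_congr_ae this]
    have : extS6 0 = 0 := by ext x; simp [extS6]
    simp [this]
  set N := (eLpNorm f p volume).toNNReal with hN
  have hNe : (N : ℝ≥0∞) = eLpNorm f p volume := ENNReal.coe_toNNReal hf.2.ne
  have hN0 : N ≠ 0 := fun h => h0 (by rw [← hNe, h]; rfl)
  have hNC : (N : ℂ) ≠ 0 := by exact_mod_cast hN0
  have hNc : ‖(N : ℂ)‖ₑ = N := by rw [← ofReal_norm]; simp
  have hfg : f = (N : ℂ) • ((N : ℂ)⁻¹ • f) := by rw [smul_smul, mul_inv_cancel₀ hNC, one_smul]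
  have hnorm : eLpNorm ((N : ℂ)⁻¹ • f) p volume ≤ 1 := by
    rw [eLpNorm_const_smul, enorm_inv hNC, hNc, ← hNe]
    exact (ENNReal.inv_mul_cancel (by simpa using hN0) (by simp)).le
  have := h _ (hfm.const_smul _) (hf.const_smul _) hnorm
  rw [hfg, extS6_const_smul, eLpNorm_const_smul, ← hfg, hNc, ← hNe, mul_comm]
  gcongr

theorem integrableOn_unitSquare {p : ℝ≥0∞} (hp : 1 ≤ p) {f : (Fin 2 → ℝ) → ℂ} (hf : MemLp f p volume) :
    IntegrableOn f unitSquare := by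
  have : IsFiniteMeasure (volume.restrict unitSquare) :=
    ⟨by simpa using volume_unitSquare_lt_top⟩
  exact (hf.restrict unitSquare).integrable hp

theorem extensionEstimateS6_of_real {p q : ℝ} (hp : 1 < p) (hq : 5 < q) (hpq : 1 / p + 4 / q < 1) :
    ExtensionEstimateS6 (ENNReal.ofReal p) (ENNReal.ofReal q) := by
  obtain ⟨C, hC⟩ := exists_eLpNorm_extS6_le_of_normalized hp hq hpq
  have hp0 : 0 < p := by linarith
  refine ⟨C, fun f hf => eLpNorm_extS6_smul_le (by simpa using hp0) (fun f hfm hf hf1 => ?_) hf⟩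
  refine hC f hfm ?_ (integrableOn_unitSquare ?_ hf)
  · rw [eLpNorm_eq_lintegral_rpow_enorm_toReal (by simpa using hp0) (by simp),
      ENNReal.toReal_ofReal hp0.le] at hf1
    have := ENNReal.rpow_le_rpow hf1 hp0.le
    rwa [← ENNReal.rpow_mul, one_div_mul_cancel hp0.ne', ENNReal.rpow_one, ENNReal.one_rpow] at this
  · rw [← ENNReal.ofReal_one]; exact ENNReal.ofReal_le_ofReal hp.le

/-- Only the values of f on the square matter, and Hölder on a set of measure 4 compares the two
norms there. -/
theorem ExtensionEstimateS6.mono_left {p p' q : ℝ≥0∞} (hpp : p' ≤ p)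
    (h : ExtensionEstimateS6 p' q) : ExtensionEstimateS6 p q := by
  obtain ⟨C, hC⟩ := h
  have : IsFiniteMeasure (volume.restrict unitSquare) :=
    ⟨by simpa using volume_unitSquare_lt_top⟩
  -- At exponent 0 `eLpNorm` is identically 0, so the hypothesis already makes the left side vanish.
  by_cases hp0 : p' = 0
  · refine ⟨0, fun f hf => ?_⟩
    have hr : MemLp (unitSquare.indicator f) p' volume := by
      rw [memLp_indicator_iff_restrict measurableSet_Icc]
      exact (hf.restrict unitSquare).mono_exponent hpp
    have := hC _ hr
    rw [extS6_indicator, hp0, eLpNorm_exponent_zero, mul_zero] at this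
    exact this.trans zero_le
  set e : ℝ := 1 / p'.toReal - 1 / p.toReal with he
  have he0 : 0 ≤ e := by
    rw [he, sub_nonneg]
    by_cases hpt : p = ∞
    · simp [hpt]
    · have h1 : 0 < p'.toReal := ENNReal.toReal_pos hp0 (ne_top_of_le_ne_top hpt hpp)
      exact one_div_le_one_div_of_le h1 (ENNReal.toReal_mono hpt hpp)
  refine ⟨C * 4 ^ e, fun f hf => ?_⟩
  have hr : MemLp (unitSquare.indicator f) p' volume := by
    rw [memLp_indicator_iff_restrict measurableSet_Icc]
    exact (hf.restrict unitSquare).mono_exponent hpp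
  have := hC _ hr
  rw [extS6_indicator, eLpNorm_indicator_eq_eLpNorm_restrict measurableSet_Icc] at this
  refine this.trans ?_
  have h2 := eLpNorm_le_eLpNorm_mul_rpow_measure_univ (μ := volume.restrict unitSquare) hpp
    (hf.restrict unitSquare).1
  rw [Measure.restrict_apply_univ, volume_unitSquare] at h2
  calc _ ≤ (C : ℝ≥0∞) * (eLpNorm f p (volume.restrict unitSquare) * 4 ^ e) := by gcongr
    _ ≤ (C : ℝ≥0∞) * (eLpNorm f p volume * 4 ^ e) := by
        gcongr
        exact Measure.restrict_le_self
    _ = _ := by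
        rw [ENNReal.coe_mul, ENNReal.coe_rpow_of_nonneg _ he0]
        push_cast
        ring

theorem extensionEstimateS6_one_top : ExtensionEstimateS6 1 ∞ := by
  refine ⟨1, fun f hf => ?_⟩
  rw [eLpNorm_one_eq_lintegral_enorm, eLpNorm_exponent_top, ENNReal.coe_one, one_mul]
  refine eLpNormEssSup_le_of_ae_enorm_bound (Filter.Eventually.of_forall fun x => ?_)
  exact (enorm_extS6_le f x).trans (setLIntegral_le_lintegral _ _)

/-- The extension estimate in the open range `q > 5`, `1 / p + 4 / q < 1`. -/
theorem extensionEstimateS6_of_lt {p q : ℝ≥0∞} (hq : 5 < q) (hpq : 1 / p + 4 / q < 1) :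
    ExtensionEstimateS6 p q := by
  have hp1 : 1 < p := by
    have : 1 / p < 1 := lt_of_le_of_lt le_self_add hpq
    rw [one_div, ENNReal.inv_lt_one] at this
    exact this
  by_cases hqt : q = ∞
  · subst hqt
    exact extensionEstimateS6_one_top.mono_left hp1.le
  have hqr : ENNReal.ofReal q.toReal = q := ENNReal.ofReal_toReal hqt
  have hq5 : 5 < q.toReal := by
    have := (ENNReal.toReal_lt_toReal (by simp) hqt).2 hq
    simpa using this
  by_cases hpt : p = ∞
  · subst hpt
    -- A finite exponent still in the range: 1/p' + 4/q = 1/2 + 2/q < 1.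
    set p' : ℝ := 2 * q.toReal / (q.toReal - 4) with hp'
    have h4 : 0 < q.toReal - 4 := by linarith
    have h1 : 1 < p' := by rw [hp', lt_div_iff₀ h4]; linarith
    refine ExtensionEstimateS6.mono_left (p' := ENNReal.ofReal p') le_top ?_
    rw [← hqr]
    refine extensionEstimateS6_of_real h1 hq5 ?_
    rw [hp', one_div_div]
    rw [div_add_div _ _ (by positivity) (by positivity), div_lt_one (by positivity)]
    nlinarith
  · have hpr : ENNReal.ofReal p.toReal = p := ENNReal.ofReal_toReal hpt
    have hp1' : 1 < p.toReal := by
      have := (ENNReal.toReal_lt_toReal (by simp) hpt).2 hp1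
      simpa using this
    rw [← hqr, ← hpr]
    refine extensionEstimateS6_of_real hp1' hq5 ?_
    have h := (ENNReal.toReal_lt_toReal hpq.ne_top (by simp)).2 hpq
    rw [ENNReal.toReal_add (by simp; exact (lt_trans zero_lt_one hp1).ne')
      (ENNReal.div_lt_top (by simp) (lt_trans (by norm_num) hq).ne').ne] at h
    simpa using h

/-! ### Failure for 1/p + 4/q > 1: a thin box -/

theorem half_le_cos_of_abs_le {t : ℝ} (ht : |t| ≤ 1 / 8) : 1 / 2 ≤ Real.cos (2 * Real.pi * t) := by
  have h1 := Real.one_sub_sq_div_two_le_cos (x := 2 * Real.pi * t)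
  have h2 : |2 * Real.pi * t| ≤ 1 := by
    rw [abs_mul, abs_of_pos (by positivity)]
    nlinarith [Real.pi_lt_four, Real.pi_pos, abs_nonneg t]
  have h3 : (2 * Real.pi * t) ^ 2 ≤ 1 := (sq_le_one_iff_abs_le_one _).2 h2
  linarith

/-- Such a small phase leaves no cancellation: the real part of the integrand is at least 1/2 on
`B`. -/
theorem half_volume_le_norm_extS6 {B : Set (Fin 2 → ℝ)} (hB : MeasurableSet B) (hBs : B ⊆ unitSquare)
    {x : Fin 4 → ℝ} (hx : ∀ ξ ∈ B, |phaseS6 x ξ| ≤ 1 / 8) :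
    volume.real B / 2 ≤ ‖extS6 (B.indicator fun _ => 1) x‖ := by
  have hBfin : volume B < ∞ := (measure_mono hBs).trans_lt volume_unitSquare_lt_top
  have h1 : extS6 (B.indicator fun _ => 1) x = ∫ ξ in B, chi (phaseS6 x ξ) := by
    rw [extS6_eq_integral_chi, ← integral_indicator measurableSet_Icc, ← integral_indicator hB]
    congr 1; ext ξ
    by_cases hξ : ξ ∈ B
    · simp [hξ, hBs hξ]
    · simp [hξ]
  have hintegrable : Integrable (fun ξ => chi (phaseS6 x ξ)) (volume.restrict B) := by
    have := integrable_mul_chi (μ := volume.restrict B) (g := fun _ => 1)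
      (integrableOn_const hBfin.ne) (measurable_phaseS6_right x)
    simpa using this
  rw [h1]
  refine le_trans ?_ (Complex.re_le_norm _)
  have h2 : (∫ ξ in B, chi (phaseS6 x ξ)).re = ∫ ξ in B, Real.cos (2 * Real.pi * phaseS6 x ξ) := by
    have := integral_re (𝕜 := ℂ) hintegrable
    simp only [RCLike.re_eq_complex_re, re_chi] at this
    exact this.symm
  rw [h2]
  calc volume.real B / 2 = ∫ ξ in B, (1 / 2 : ℝ) := by simp; ring
    _ ≤ _ := by
      refine setIntegral_mono_on (integrableOn_const hBfin.ne) ?_ hB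
        fun ξ hξ => half_le_cos_of_abs_le (hx ξ hξ)
      have := hintegrable.re
      simp only [RCLike.re_eq_complex_re, re_chi] at this
      exact this

/-- The box `[0, δ] × [0, 1]`. -/
def thinBox (δ : ℝ) : Set (Fin 2 → ℝ) := Set.Icc ![0, 0] ![δ, 1]

/-- The box dual to `thinBox δ`. -/
noncomputable def dualBox (δ : ℝ) : Set (Fin 4 → ℝ) :=
  Set.Icc (-![1 / (32 * δ), 1 / 32, 1 / (32 * δ ^ 2), 1 / (32 * δ)])
    ![1 / (32 * δ), 1 / 32, 1 / (32 * δ ^ 2), 1 / (32 * δ)]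

theorem volume_thinBox (δ : ℝ) : volume (thinBox δ) = ENNReal.ofReal δ := by
  rw [thinBox, Real.volume_Icc_pi]
  simp

theorem volume_dualBox {δ : ℝ} (hδ : 0 < δ) :
    volume (dualBox δ) = ENNReal.ofReal ((1 / 16) ^ 4 * δ ^ (-4 : ℝ)) := by
  rw [dualBox, Real.volume_Icc_pi, ← ENNReal.ofReal_prod_of_nonneg]
  · congr 1
    rw [Fin.prod_univ_four, Real.rpow_neg hδ.le]
    simp
    field_simp
    norm_num
  · intro i _
    fin_cases i <;> simp <;> positivity

theorem thinBox_subset {δ : ℝ} (hδ1 : δ ≤ 1) : thinBox δ ⊆ unitSquare := by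
  intro ξ hξ
  simp only [thinBox, Set.mem_Icc, Pi.le_def, Fin.forall_fin_two] at hξ ⊢
  simp at hξ ⊢
  refine ⟨⟨by linarith, by linarith⟩, by linarith, by linarith⟩

/-- Each of the four terms of the phase is at most 1/32; this fixes the constants in `dualBox`. -/
theorem abs_phaseS6_le_of_mem {δ : ℝ} (hδ : 0 < δ) {x : Fin 4 → ℝ}
    (hx : x ∈ dualBox δ) {ξ : Fin 2 → ℝ} (hξ : ξ ∈ thinBox δ) : |phaseS6 x ξ| ≤ 1 / 8 := by
  simp only [thinBox, Set.mem_Icc, Pi.le_def, Fin.forall_fin_two] at hξ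
  simp only [dualBox, Set.mem_Icc, Pi.le_def, Fin.forall_fin_succ] at hx
  simp at hξ hx
  obtain ⟨⟨h1, h2⟩, h3, h4⟩ := hξ
  have key : ∀ a b u v : ℝ, 0 ≤ a → a ≤ u → |b| ≤ v → u * v = 1 / 32 → |a * b| ≤ 1 / 32 := by
    intro a b u v ha hau hb huv
    rw [abs_mul, abs_of_nonneg ha, ← huv]
    exact mul_le_mul hau hb (abs_nonneg _) (ha.trans hau)
  have k0 : |ξ 0 * x 0| ≤ 1 / 32 := key _ _ δ (δ⁻¹ * 32⁻¹) h1 h3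
    (abs_le.2 ⟨by linarith [hx.1.1], by linarith [hx.2.1]⟩) (by field_simp)
  have k1 : |ξ 1 * x 1| ≤ 1 / 32 := key _ _ 1 32⁻¹ h2 h4
    (abs_le.2 ⟨by linarith [hx.1.2.1], by linarith [hx.2.2.1]⟩) (by norm_num)
  have k2 : |ξ 0 ^ 2 * x 2| ≤ 1 / 32 := key _ _ (δ ^ 2) ((δ ^ 2)⁻¹ * 32⁻¹) (by positivity)
    (by gcongr)
    (abs_le.2 ⟨by linarith [hx.1.2.2.1], by linarith [hx.2.2.2.1]⟩) (by field_simp)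
  have k3 : |ξ 0 * ξ 1 * x 3| ≤ 1 / 32 := key _ _ δ (δ⁻¹ * 32⁻¹) (by positivity)
    (by nlinarith)
    (abs_le.2 ⟨by linarith [hx.1.2.2.2], by linarith [hx.2.2.2.2]⟩) (by field_simp)
  unfold phaseS6
  rw [abs_le] at *
  constructor <;> linarith [k0.1, k0.2, k1.1, k1.2, k2.1, k2.2, k3.1, k3.2]

theorem exists_rpow_mul_lt {s : ℝ} (hs : 0 < s) (C : ℝ) {c : ℝ} (hc : 0 < c) :
    ∃ δ : ℝ, 0 < δ ∧ δ ≤ 1 ∧ C * δ ^ s < c := by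
  have h : Filter.Tendsto (fun δ : ℝ => C * δ ^ s) (nhdsWithin 0 (Set.Ioi 0)) (nhds 0) := by
    have h1 := ((Real.continuousAt_rpow_const 0 s (Or.inr hs.le)).tendsto.const_mul C)
    rw [Real.zero_rpow hs.ne', mul_zero] at h1
    exact h1.mono_left nhdsWithin_le_nhds
  have h2 := h.eventually (gt_mem_nhds hc)
  have h3 : ∀ᶠ δ : ℝ in nhdsWithin 0 (Set.Ioi 0), δ ∈ Set.Ioc (0 : ℝ) 1 :=
    Ioc_mem_nhdsGT (by norm_num)
  obtain ⟨δ, hδ1, hδ2⟩ := (h2.and h3).exists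
  exact ⟨δ, hδ2.1, hδ2.2, hδ1⟩

/-- Failure of the extension estimate for `1 / p + 4 / q > 1`, tested on `[0, δ] × [0, 1]`. -/
theorem not_extensionEstimateS6_of_one_lt {p q : ℝ≥0∞} (hp : 0 < p) (hq : 0 < q)
    (hpq : 1 < 1 / p + 4 / q) : ¬ ExtensionEstimateS6 p q := by
  rintro ⟨C, hC⟩
  set A := 1 / q.toReal with hA
  set B := 1 / p.toReal with hB
  have hA0 : 0 ≤ A := by positivity
  have hB0 : 0 ≤ B := by positivity
  have hAB : 1 < B + 4 * A := by
    have hp' : 1 / p ≠ ∞ := by simpa using hp.ne'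
    have hq' : 4 / q ≠ ∞ := (ENNReal.div_lt_top (by simp) hq.ne').ne
    have h := (ENNReal.toReal_lt_toReal (by simp) (ENNReal.add_ne_top.2 ⟨hp', hq'⟩)).2 hpq
    rw [ENNReal.toReal_add hp' hq'] at h
    simp at h
    rw [hA, hB, one_div, one_div]
    simpa [div_eq_mul_inv] using h
  set K : ℝ := (1 / 16) ^ 4 with hK
  have hK0 : 0 < K := by positivity
  -- The estimate would give K^A / 2 ≤ C δ^(B + 4A - 1) after division by δ^(1 - 4A), and the
  -- exponent is positive.
  obtain ⟨δ, hδ0, hδ1, hδ⟩ := exists_rpow_mul_lt (s := B + 4 * A - 1) (by linarith) C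
    (c := K ^ A / 2) (by positivity)
  have hbox : MeasurableSet (thinBox δ) := measurableSet_Icc
  have hdual : MeasurableSet (dualBox δ) := measurableSet_Icc
  set f : (Fin 2 → ℝ) → ℂ := (thinBox δ).indicator fun _ => 1 with hf
  have hvB : volume (thinBox δ) ≠ 0 := by rw [volume_thinBox]; simpa using hδ0
  have hvD : volume (dualBox δ) ≠ 0 := by
    rw [volume_dualBox hδ0]; simp only [ne_eq, ENNReal.ofReal_eq_zero, not_le]; positivity
  have hmem : MemLp f p volume := memLp_indicator_const p hbox 1 (Or.inr (by simp [volume_thinBox]))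
  have hfn : eLpNorm f p volume = ENNReal.ofReal (δ ^ B) := by
    rw [hf, eLpNorm_indicator_const' hbox hvB hp.ne', volume_thinBox, enorm_one, one_mul,
      ENNReal.ofReal_rpow_of_pos hδ0]
  have hlow : ENNReal.ofReal (δ / 2 * (K * δ ^ (-4 : ℝ)) ^ A) ≤ eLpNorm (extS6 f) q volume := by
    have h1 : eLpNorm ((dualBox δ).indicator fun _ => (δ / 2 : ℝ)) q volume =
        ENNReal.ofReal (δ / 2 * (K * δ ^ (-4 : ℝ)) ^ A) := by
      rw [eLpNorm_indicator_const' hdual hvD hq.ne', volume_dualBox hδ0,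
        ENNReal.ofReal_rpow_of_pos (by positivity), Real.enorm_of_nonneg (by positivity),
        ← ENNReal.ofReal_mul (by positivity)]
    rw [← h1]
    refine eLpNorm_mono fun x => ?_
    by_cases hx : x ∈ dualBox δ
    · rw [Set.indicator_of_mem hx, Real.norm_of_nonneg (by positivity)]
      have := half_volume_le_norm_extS6 hbox (thinBox_subset hδ1)
        (fun ξ hξ => abs_phaseS6_le_of_mem hδ0 hx hξ)
      rwa [Measure.real, volume_thinBox, ENNReal.toReal_ofReal hδ0.le] at this
    · rw [Set.indicator_of_notMem hx]; simp
  have h := hlow.trans (hC f hmem)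
  rw [hfn, ← ENNReal.ofReal_coe_nnreal, ← ENNReal.ofReal_mul (by positivity),
    ENNReal.ofReal_le_ofReal_iff (by positivity), Real.mul_rpow (by positivity) (by positivity),
    ← Real.rpow_mul hδ0.le] at h
  have h5 : δ / 2 * (K ^ A * δ ^ (-4 * A)) = K ^ A / 2 * δ ^ (1 - 4 * A) := by
    rw [sub_eq_add_neg, Real.rpow_add hδ0, Real.rpow_one, neg_mul]; ring
  have h6 : C * δ ^ B = C * δ ^ (B + 4 * A - 1) * δ ^ (1 - 4 * A) := by
    rw [mul_assoc, ← Real.rpow_add hδ0]; congr 2; ring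
  rw [h5, h6] at h
  have h7 := le_of_mul_le_mul_right h (by positivity)
  linarith

/-! ### The Fejér kernel and a minorant with positive integral -/

/-- The Fejér kernel, as the Fourier transform of the tent function. -/
noncomputable def fejer (y : ℝ) : ℝ := ∫ w in (0 : ℝ)..1, 2 * (1 - w) * Real.cos (2 * Real.pi * y * w)

theorem integral_tent_mul_chi (y : ℝ) :
    ∫ w in Set.Icc (-1 : ℝ) 1, ((1 - |w| : ℝ) : ℂ) * chi (w * y) = fejer y := by
  have hc : Continuous fun w : ℝ => ((1 - |w| : ℝ) : ℂ) * chi (w * y) := by fun_prop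
  rw [integral_Icc_eq_integral_Ioc, ← intervalIntegral.integral_of_le (by norm_num),
    ← intervalIntegral.integral_add_adjacent_intervals (b := 0) (hc.intervalIntegrable _ _)
      (hc.intervalIntegrable _ _)]
  have h1 : ∫ w in (-1 : ℝ)..0, ((1 - |w| : ℝ) : ℂ) * chi (w * y) =
      ∫ w in (0 : ℝ)..1, ((1 - |w| : ℝ) : ℂ) * chi (-(w * y)) := by
    have := intervalIntegral.integral_comp_neg (a := 0) (b := 1)
      (fun w : ℝ => ((1 - |w| : ℝ) : ℂ) * chi (w * y))
    rw [neg_zero] at this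
    rw [← this]
    simp
  rw [h1, ← intervalIntegral.integral_add (Continuous.intervalIntegrable (by fun_prop) _ _)
    (hc.intervalIntegrable _ _), fejer, ← intervalIntegral.integral_ofReal]
  refine intervalIntegral.integral_congr fun w hw => ?_
  rw [Set.uIcc_of_le (by norm_num)] at hw
  have h2 : chi (-(w * y)) + chi (w * y) = ((2 * Real.cos (2 * Real.pi * y * w) : ℝ) : ℂ) := by
    rw [← conj_chi, add_comm, Complex.add_conj, re_chi]
    congr 3; ring
  rw [← mul_add, h2, abs_of_nonneg hw.1, ← Complex.ofReal_mul]
  congr 1; ring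

theorem fejer_eq {y : ℝ} (hy : y ≠ 0) : fejer y = (Real.sin (Real.pi * y) / (Real.pi * y)) ^ 2 := by
  have ha : 2 * Real.pi * y ≠ 0 := by positivity
  set a := 2 * Real.pi * y with hadef
  have h : ∀ w ∈ Set.uIcc (0 : ℝ) 1, HasDerivAt
      (fun w => 2 * ((1 - w) * (Real.sin (a * w) / a) - Real.cos (a * w) / a ^ 2))
      (2 * (1 - w) * Real.cos (a * w)) w := by
    intro w _
    have hw : HasDerivAt (fun w : ℝ => a * w) a w := by simpa using (hasDerivAt_id w).const_mul a
    have h1 := (hw.sin).div_const a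
    have h2 := (hw.cos).div_const (a ^ 2)
    have h3 : HasDerivAt (fun w : ℝ => 1 - w) (-1) w := by simpa using (hasDerivAt_id w).const_sub 1
    refine (((h3.mul h1).sub h2).const_mul 2).congr_deriv ?_
    field_simp
    ring
  rw [fejer, intervalIntegral.integral_eq_sub_of_hasDerivAt h
    (Continuous.intervalIntegrable (by fun_prop) _ _)]
  have hcos : Real.cos a = 1 - 2 * Real.sin (Real.pi * y) ^ 2 := by
    rw [hadef, mul_assoc, Real.cos_two_mul]
    nlinarith [Real.sin_sq_add_cos_sq (Real.pi * y)]
  simp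
  rw [hcos, hadef]
  have := Real.pi_ne_zero
  field_simp
  ring

theorem fejer_nonneg (y : ℝ) : 0 ≤ fejer y := by
  rcases eq_or_ne y 0 with rfl | hy
  · rw [fejer]
    refine intervalIntegral.integral_nonneg (by norm_num) fun w hw => ?_
    simp only [mul_zero, zero_mul, Real.cos_zero, mul_one]
    linarith [hw.2]
  · rw [fejer_eq hy]; positivity

theorem fejer_le {y : ℝ} (hy : y ≠ 0) : fejer y ≤ 1 / (9 * y ^ 2) := by
  rw [fejer_eq hy, div_pow, mul_pow]
  have h1 : Real.sin (Real.pi * y) ^ 2 ≤ 1 := Real.sin_sq_le_one _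
  have h2 : 0 < y ^ 2 := by positivity
  have h3 : 9 ≤ Real.pi ^ 2 := by nlinarith [Real.pi_gt_three]
  gcongr

theorem quarter_le_fejer {y : ℝ} (hy : |y| ≤ 1 / 2) : 1 / 4 ≤ fejer y := by
  rcases eq_or_ne y 0 with rfl | hy0
  · have : fejer 0 = 1 := by
      rw [fejer]
      simp only [mul_zero, zero_mul, Real.cos_zero, mul_one]
      rw [intervalIntegral.integral_const_mul, intervalIntegral.integral_sub (by simp) (by simp)]
      simp; norm_num
    rw [this]; norm_num
  · rw [fejer_eq hy0]
    have habs : (Real.sin (Real.pi * y) / (Real.pi * y)) ^ 2 =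
        (Real.sin (Real.pi * |y|) / (Real.pi * |y|)) ^ 2 := by
      rcases abs_cases y with ⟨h, _⟩ | ⟨h, _⟩ <;> rw [h]
      rw [mul_neg, Real.sin_neg, neg_div_neg_eq]
    rw [habs]
    have hyp : 0 < |y| := abs_pos.2 hy0
    have h1 := Real.mul_le_sin (x := Real.pi * |y|) (by positivity)
      (by nlinarith [Real.pi_pos])
    have h2 : 1 / 2 ≤ Real.sin (Real.pi * |y|) / (Real.pi * |y|) := by
      rw [le_div_iff₀ (by positivity)]
      refine le_trans ?_ h1
      have : 1 / 2 ≤ 2 / Real.pi := by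
        rw [div_le_div_iff₀ (by norm_num) Real.pi_pos]; linarith [Real.pi_lt_four]
      gcongr
    nlinarith

/-- A minorant for a modulated Fejér kernel. -/
noncomputable def fejerMinorant (y : ℝ) : ℝ :=
  (Set.Icc (-(1 / 2) : ℝ) (1 / 2)).indicator (fun _ => 1 / 8) y -
    (Set.Ioi (4 : ℝ)).indicator (fun r => 1 / (9 * r ^ 2)) |y|

theorem integrable_fejerTail :
    Integrable fun y : ℝ => (Set.Ioi (4 : ℝ)).indicator (fun r => 1 / (9 * r ^ 2)) |y| := by
  refine integrable_inv_one_add_sq.mono' ?_ (Filter.Eventually.of_forall fun y => ?_)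
  · refine Measurable.aestronglyMeasurable ?_
    exact (Measurable.indicator (by fun_prop) measurableSet_Ioi).comp measurable_abs
  · by_cases hy : |y| ∈ Set.Ioi (4 : ℝ)
    · rw [Set.indicator_of_mem hy, Real.norm_of_nonneg (by positivity), sq_abs, ← one_div]
      have : 4 < |y| := hy
      have h2 : 16 < y ^ 2 := by rw [← sq_abs]; nlinarith
      gcongr
      linarith
    · rw [Set.indicator_of_notMem hy, norm_zero]; positivity

theorem integral_fejerTail :
    ∫ y : ℝ, (Set.Ioi (4 : ℝ)).indicator (fun r => 1 / (9 * r ^ 2)) |y| = 1 / 18 := by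
  rw [integral_comp_abs (f := (Set.Ioi (4 : ℝ)).indicator fun r => 1 / (9 * r ^ 2)),
    setIntegral_indicator measurableSet_Ioi,
    Set.inter_eq_right.2 (Set.Ioi_subset_Ioi (by norm_num : (0 : ℝ) ≤ 4))]
  have h : ∫ r in Set.Ioi (4 : ℝ), 1 / (9 * r ^ 2) = ∫ r in Set.Ioi (4 : ℝ), 1 / 9 * r ^ (-2 : ℝ) := by
    refine setIntegral_congr_fun measurableSet_Ioi fun r hr => ?_
    have hr0 : (0 : ℝ) < r := lt_trans (by norm_num) hr
    rw [Real.rpow_neg hr0.le, Real.rpow_two]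
    field_simp
  rw [h, integral_const_mul, integral_Ioi_rpow_of_lt (by norm_num) (by norm_num)]
  norm_num [Real.rpow_neg_one]

theorem integrable_fejerMinorant : Integrable fejerMinorant := by
  refine Integrable.sub ?_ integrable_fejerTail
  exact (integrable_indicator_iff measurableSet_Icc).2 (integrableOn_const (by simp))

/-- The central mass 1/8 beats the tail 1/18. The cutoff 4 is far enough out for this to be
positive. -/
theorem integral_fejerMinorant : ∫ y, fejerMinorant y = 5 / 72 := by
  unfold fejerMinorant
  rw [integral_sub ((integrable_indicator_iff measurableSet_Icc).2 (integrableOn_const (by simp)))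
    integrable_fejerTail, integral_fejerTail, integral_indicator measurableSet_Icc]
  simp; norm_num

/-- For |y| ≤ 4 the cosine is at least 1/2: the product is then nonnegative, and at least 1/4 · 1/2
for |y| ≤ 1/2. For |y| > 4 nothing is known about the phase, and the kernel decay bounds the loss.
-/
theorem fejerMinorant_le {y ψ : ℝ} (hψ : |y| ≤ 4 → |ψ| ≤ 1 / 8) :
    fejerMinorant y ≤ fejer y * Real.cos (2 * Real.pi * ψ) := by
  unfold fejerMinorant
  have h0 := fejer_nonneg y
  by_cases h4 : 4 < |y|
  · have h1 : y ∉ Set.Icc (-(1 / 2) : ℝ) (1 / 2) := fun h => by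
      have := abs_le.2 h; linarith
    have hy0 : y ≠ 0 := by rintro rfl; simp at h4; linarith
    rw [Set.indicator_of_notMem h1, Set.indicator_of_mem (show |y| ∈ Set.Ioi (4 : ℝ) from h4), sq_abs]
    have := fejer_le hy0
    have := Real.neg_one_le_cos (2 * Real.pi * ψ)
    nlinarith
  · have hc := half_le_cos_of_abs_le (hψ (not_lt.1 h4))
    rw [Set.indicator_of_notMem (show |y| ∉ Set.Ioi (4 : ℝ) from h4), sub_zero]
    by_cases h2 : y ∈ Set.Icc (-(1 / 2) : ℝ) (1 / 2)
    · rw [Set.indicator_of_mem h2]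
      have := quarter_le_fejer (abs_le.2 h2)
      nlinarith
    · rw [Set.indicator_of_notMem h2]; nlinarith

theorem fejerMinorant_nonpos {y : ℝ} (hy : 1 / 2 < |y|) : fejerMinorant y ≤ 0 := by
  unfold fejerMinorant
  have h1 : y ∉ Set.Icc (-(1 / 2) : ℝ) (1 / 2) := fun h => by
    have := abs_le.2 h; linarith
  rw [Set.indicator_of_notMem h1, zero_sub, neg_nonpos]
  exact Set.indicator_nonneg (fun r _ => by positivity) _

theorem integral_fejerMinorant_comp {b d : ℝ} (hd : 0 < d) :
    ∫ s, fejerMinorant (b + s * d) = d⁻¹ * (5 / 72) := by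
  rw [Measure.integral_comp_mul_right (fun u => fejerMinorant (b + u)) d,
    integral_add_left_eq_self fejerMinorant b, integral_fejerMinorant, abs_of_pos (by positivity),
    smul_eq_mul]

/-! ### Failure for q < 5: the tent function -/

/-- The tent function in the second variable. -/
noncomputable def tent (ξ : Fin 2 → ℝ) : ℂ := ((1 - |ξ 1| : ℝ) : ℂ)

theorem integrable_tent :
    Integrable fun z : ℝ × ℝ => unitSquare.indicator tent ![z.1, z.2] := by
  have hc : ContinuousOn tent unitSquare := by unfold tent; fun_prop
  have h : Integrable (unitSquare.indicator tent) :=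
    (hc.integrableOn_compact isCompact_Icc).integrable_indicator measurableSet_Icc
  exact (volume_preserving_finTwoArrow ℝ).symm.integrable_comp_of_integrable h

theorem partialFourier_tent {s : ℝ} (hs : s ∈ Set.Icc (-1 : ℝ) 1) (y : ℝ) :
    partialFourier (fun z : ℝ × ℝ => unitSquare.indicator tent ![z.1, z.2]) s y = fejer y := by
  rw [← integral_tent_mul_chi, ← integral_indicator measurableSet_Icc, partialFourier]
  congr 1; ext w
  by_cases hw : w ∈ Set.Icc (-1 : ℝ) 1
  · rw [Set.indicator_of_mem hw, Set.indicator_of_mem (mem_Icc_vec_two.2 ⟨hs, hw⟩)]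
    simp [tent]
  · rw [Set.indicator_of_notMem hw, Set.indicator_of_notMem (fun h => hw (mem_Icc_vec_two.1 h).2),
      zero_mul]

theorem continuous_fejer : Continuous fejer := by
  unfold fejer
  exact intervalIntegral.continuous_parametric_intervalIntegral_of_continuous' (by fun_prop) _ _

theorem extS6_tent (a b c d : ℝ) :
    extS6 tent ![a, b, c, d] =
      ∫ s in Set.Icc (-1 : ℝ) 1, (fejer (b + s * d) : ℂ) * chi (s * a + s ^ 2 * c) := by
  rw [extS6_eq_integral_partialFourier integrable_tent, ← integral_indicator measurableSet_Icc]
  congr 1; ext s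
  by_cases hs : s ∈ Set.Icc (-1 : ℝ) 1
  · rw [Set.indicator_of_mem hs, partialFourier_tent hs]
  · rw [Set.indicator_of_notMem hs, partialFourier_eq_zero (fun z hz => Set.indicator_of_notMem
      (fun h => hz (mem_Icc_vec_two.1 h)) _) hs, zero_mul]

/-- The kernel concentrates at s = -b/d with width ~ 1/R. The conditions on a and c keep the phase
nearly constant where |b + s d| ≤ 4, since a - 2(b/d)c is its derivative at that centre and c its
quadratic coefficient. -/
theorem le_norm_extS6_tent {R a b c d : ℝ} (hR : 1 ≤ R) (hb : |b| ≤ R / 2) (hd : R ≤ d)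
    (hd2 : d ≤ 2 * R) (hc : |c| ≤ R ^ 2 / 160) (ha : |a - 2 * (b / d) * c| ≤ R / 160) :
    1 / (32 * R) ≤ ‖extS6 tent ![a, b, c, d]‖ := by
  have hd0 : 0 < d := by linarith
  -- The value of the phase at the centre s = -b/d; removing it is a unimodular factor.
  set γ : ℝ := -(b / d) * a + (b / d) ^ 2 * c with hγ
  have hcf := continuous_fejer
  have hintegrable : Integrable (fun s => ((fejer (b + s * d) : ℂ) * chi (s * a + s ^ 2 * c)) * chi (-γ))
      (volume.restrict (Set.Icc (-1 : ℝ) 1)) :=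
    (Continuous.continuousOn (by fun_prop)).integrableOn_compact isCompact_Icc
  have hre : ∀ s, (((fejer (b + s * d) : ℂ) * chi (s * a + s ^ 2 * c)) * chi (-γ)).re =
      fejer (b + s * d) * Real.cos (2 * Real.pi * (s * a + s ^ 2 * c - γ)) := by
    intro s
    rw [mul_assoc, ← chi_add, Complex.re_ofReal_mul, re_chi, sub_eq_add_neg]
  have h1 : ‖extS6 tent ![a, b, c, d]‖ =
      ‖∫ s in Set.Icc (-1 : ℝ) 1, ((fejer (b + s * d) : ℂ) * chi (s * a + s ^ 2 * c)) * chi (-γ)‖ := by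
    rw [integral_mul_const, norm_mul, norm_chi, mul_one, extS6_tent]
  have h2 : (∫ s in Set.Icc (-1 : ℝ) 1,
        ((fejer (b + s * d) : ℂ) * chi (s * a + s ^ 2 * c)) * chi (-γ)).re =
      ∫ s in Set.Icc (-1 : ℝ) 1, fejer (b + s * d) *
        Real.cos (2 * Real.pi * (s * a + s ^ 2 * c - γ)) := by
    have := integral_re (𝕜 := ℂ) hintegrable
    simp only [RCLike.re_eq_complex_re, hre] at this
    exact this.symm
  have hphase : ∀ s, |b + s * d| ≤ 4 → |s * a + s ^ 2 * c - γ| ≤ 1 / 8 := by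
    intro s hs
    set y := b + s * d with hy
    have e : s * a + s ^ 2 * c - γ = y / d * (a - 2 * (b / d) * c) + (y / d) ^ 2 * c := by
      have : s = (y - b) / d := by rw [hy]; field_simp; ring
      rw [this, hγ]; field_simp; ring
    have hyd : |y / d| ≤ 4 / R := by
      rw [abs_div, abs_of_pos hd0]; gcongr
    have k1 : |y / d * (a - 2 * (b / d) * c)| ≤ 1 / 40 := by
      rw [abs_mul]
      calc _ ≤ 4 / R * (R / 160) := by gcongr
        _ = 1 / 40 := by field_simp; norm_num
    have k2 : |(y / d) ^ 2 * c| ≤ 1 / 10 := by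
      rw [abs_mul, abs_pow]
      calc _ ≤ (4 / R) ^ 2 * (R ^ 2 / 160) := by gcongr
        _ = 1 / 10 := by field_simp; norm_num
    rw [e]
    refine (abs_add_le _ _).trans ?_
    linarith
  rw [h1]
  refine le_trans ?_ (Complex.re_le_norm _)
  rw [h2, ← integral_indicator measurableSet_Icc]
  have hmin : Integrable fun s => fejerMinorant (b + s * d) :=
    (integrable_fejerMinorant.comp_add_left b).comp_mul_right' hd0.ne'
  -- Since d ≤ 2R, the right side is at least 5/(144R), which exceeds 1/(32R).
  calc 1 / (32 * R) ≤ d⁻¹ * (5 / 72) := by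
        rw [← one_div, div_mul_div_comm, div_le_div_iff₀ (by positivity) (by positivity)]
        nlinarith
    _ = ∫ s, fejerMinorant (b + s * d) := (integral_fejerMinorant_comp hd0).symm
    _ ≤ _ := by
        refine integral_mono hmin ?_ fun s => ?_
        · rw [integrable_indicator_iff measurableSet_Icc]
          exact (Continuous.continuousOn (by fun_prop)).integrableOn_compact isCompact_Icc
        · simp only
          by_cases hs : s ∈ Set.Icc (-1 : ℝ) 1
          · rw [Set.indicator_of_mem hs]
            exact fejerMinorant_le (hphase s)
          · rw [Set.indicator_of_notMem hs]
            -- For |s| > 1 one has |b + s d| > d - R/2 ≥ 1/2, so extending the minorant's integral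
            -- from [-1, 1] to ℝ can only lower it.
            refine fejerMinorant_nonpos ?_
            have hs1 : 1 < |s| := by
              by_contra h
              exact hs (abs_le.1 (not_lt.1 h))
            have h3 : |s * d| - |b| ≤ |b + s * d| := by
              have := abs_sub_abs_le_abs_sub (s * d) (-b)
              rwa [abs_neg, sub_neg_eq_add, add_comm (s * d) b] at this
            rw [abs_mul, abs_of_pos hd0] at h3
            nlinarith

/-- The pointwise bound (32R)⁻¹ holds on a set with b and d in intervals of length R, c in one of
length R²/80, and a in one of length R/80 centred at 2(b/d)c. Its measure is R⁵/80². -/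
theorem lintegral_extS6_tent_ge {q R : ℝ} (hq : 0 < q) (hR : 1 ≤ R) :
    ENNReal.ofReal ((1 / 32) ^ q * (1 / 80) ^ 2 * R ^ (5 - q)) ≤
      ∫⁻ x, ‖extS6 tent x‖ₑ ^ q := by
  have hR0 : 0 < R := by linarith
  have htm : Measurable tent := by unfold tent; fun_prop
  have hEm : Measurable fun x => ‖extS6 tent x‖ₑ ^ q := (measurable_extS6 htm).enorm.pow_const _
  rw [lintegral_fin_four hEm]
  set K : ℝ≥0∞ := ENNReal.ofReal ((1 / (32 * R)) ^ q) with hK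
  set I := Set.Icc (-(R / 2)) (R / 2) ×ˢ Set.Icc R (2 * R) with hI
  have hinner : ∀ z ∈ I, K * ENNReal.ofReal (R / 80) * ENNReal.ofReal (R ^ 2 / 80) ≤
      ∫⁻ y : ℝ × ℝ, ‖extS6 tent ![y.1, z.1, y.2, z.2]‖ₑ ^ q := by
    rintro ⟨b, d⟩ ⟨hb, hd⟩
    simp only at hb hd ⊢
    have hm : Measurable fun y : ℝ × ℝ => ‖extS6 tent ![y.1, b, y.2, d]‖ₑ ^ q :=
      hEm.comp (measurePreserving_fin_four.measurable.comp
        (measurable_prodMk_left (x := ((b, d) : ℝ × ℝ))))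
    rw [Measure.volume_eq_prod, lintegral_prod_symm _ hm.aemeasurable]
    calc K * ENNReal.ofReal (R / 80) * ENNReal.ofReal (R ^ 2 / 80)
        = ∫⁻ c in Set.Icc (-(R ^ 2 / 160)) (R ^ 2 / 160), K * ENNReal.ofReal (R / 80) := by
          rw [setLIntegral_const, Real.volume_Icc]
          congr 2; ring
      _ ≤ ∫⁻ c in Set.Icc (-(R ^ 2 / 160)) (R ^ 2 / 160),
            ∫⁻ a : ℝ, ‖extS6 tent ![a, b, c, d]‖ₑ ^ q := by
          refine setLIntegral_mono' measurableSet_Icc fun c hc => ?_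
          set e := 2 * (b / d) * c with he
          calc K * ENNReal.ofReal (R / 80) = ∫⁻ a in Set.Icc (e - R / 160) (e + R / 160), K := by
                rw [setLIntegral_const, Real.volume_Icc]
                congr 2; ring
            _ ≤ ∫⁻ a in Set.Icc (e - R / 160) (e + R / 160), ‖extS6 tent ![a, b, c, d]‖ₑ ^ q := by
                refine setLIntegral_mono' measurableSet_Icc fun a ha => ?_
                have := le_norm_extS6_tent (a := a) hR (abs_le.2 hb) hd.1 hd.2 (abs_le.2 hc)
                  (abs_le.2 ⟨by linarith [ha.1], by linarith [ha.2]⟩)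
                rw [hK, ← ofReal_norm, ← ENNReal.ofReal_rpow_of_pos (by positivity)]
                gcongr
            _ ≤ _ := setLIntegral_le_lintegral _ _
      _ ≤ _ := setLIntegral_le_lintegral _ _
  calc _ = ∫⁻ z in I, K * ENNReal.ofReal (R / 80) * ENNReal.ofReal (R ^ 2 / 80) := by
        rw [setLIntegral_const, hI, Measure.volume_eq_prod, Measure.prod_prod, Real.volume_Icc,
          Real.volume_Icc, hK, ← ENNReal.ofReal_mul (by positivity), ← ENNReal.ofReal_mul (by positivity),
          ← ENNReal.ofReal_mul (by linarith), ← ENNReal.ofReal_mul (by positivity)]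
        congr 1
        have e1 : (1 / (32 * R)) ^ q = (1 / 32) ^ q * R ^ (-q) := by
          rw [Real.rpow_neg hR0.le, ← Real.inv_rpow hR0.le, ← Real.mul_rpow (by norm_num) (by positivity)]
          congr 1; field_simp
        have e2 : R ^ (5 - q) = R ^ (-q) * R ^ 5 := by
          rw [← Real.rpow_natCast, ← Real.rpow_add hR0]; congr 1; push_cast; ring
        rw [e1, e2]; ring
    _ ≤ ∫⁻ z in I, ∫⁻ y : ℝ × ℝ, ‖extS6 tent ![y.1, z.1, y.2, z.2]‖ₑ ^ q :=
        setLIntegral_mono' (measurableSet_Icc.prod measurableSet_Icc) hinner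
    _ ≤ _ := setLIntegral_le_lintegral _ _

/-- Failure of the extension estimate for `q < 5`, tested on the tent function. -/
theorem not_extensionEstimateS6_of_lt_five {p q : ℝ≥0∞} (hq : 0 < q) (hq5 : q < 5) :
    ¬ ExtensionEstimateS6 p q := by
  rintro ⟨C, hC⟩
  have hqt : q ≠ ∞ := hq5.ne_top
  have hq0 : 0 < q.toReal := ENNReal.toReal_pos hq.ne' hqt
  have hq5' : q.toReal < 5 := by
    have := (ENNReal.toReal_lt_toReal hqt (by simp)).2 hq5
    simpa using this
  have hmem : MemLp (unitSquare.indicator tent) p volume := by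
    refine (memLp_indicator_const p (measurableSet_Icc : MeasurableSet unitSquare) (1 : ℝ)
      (Or.inr volume_unitSquare_lt_top.ne)).mono ?_ (Filter.Eventually.of_forall fun ξ => ?_)
    · refine (Measurable.indicator ?_ measurableSet_Icc).aestronglyMeasurable
      unfold tent; fun_prop
    · by_cases hξ : ξ ∈ unitSquare
      · rw [Set.indicator_of_mem hξ, Set.indicator_of_mem hξ, tent, Complex.norm_real, norm_one,
          Real.norm_eq_abs, abs_le]
        have h1 : |ξ 1| ≤ 1 := abs_le.2 ⟨hξ.1 1, hξ.2 1⟩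
        have := abs_nonneg (ξ 1)
        constructor <;> linarith
      · rw [Set.indicator_of_notMem hξ, Set.indicator_of_notMem hξ]; simp
  have h := hC _ hmem
  rw [extS6_indicator] at h
  have hfin : eLpNorm (extS6 tent) q volume < ∞ :=
    h.trans_lt (ENNReal.mul_lt_top ENNReal.coe_lt_top hmem.2)
  rw [eLpNorm_lt_top_iff_lintegral_rpow_enorm_lt_top hq.ne' hqt] at hfin
  set B := (∫⁻ x, ‖extS6 tent x‖ₑ ^ q.toReal).toReal with hB
  have hk : 0 < (1 / 32 : ℝ) ^ q.toReal * (1 / 80) ^ 2 := by positivity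
  have hbound : ∀ R : ℝ, 1 ≤ R →
      (1 / 32 : ℝ) ^ q.toReal * (1 / 80) ^ 2 * R ^ (5 - q.toReal) ≤ B := fun R hR =>
    (ENNReal.ofReal_le_iff_le_toReal hfin.ne).1 (lintegral_extS6_tent_ge hq0 hR)
  have htend := (tendsto_rpow_atTop (show 0 < 5 - q.toReal by linarith)).const_mul_atTop hk
  obtain ⟨R, hR1, hR2⟩ := ((htend.eventually_gt_atTop B).and (Filter.eventually_ge_atTop 1)).exists
  exact absurd (hbound R hR2) (not_le.2 hR1)

theorem proposition8p2 :
    (∀ p q : ℝ≥0∞, 5 < q → 1 / p + 4 / q < 1 → ExtensionEstimateS6 p q) ∧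
    (∀ p q : ℝ≥0∞, 0 < p → 0 < q → (q < 5 ∨ 1 < 1 / p + 4 / q) →
      ¬ ExtensionEstimateS6 p q) := by
  refine ⟨fun p q hq hpq => extensionEstimateS6_of_lt hq hpq, fun p q hp hq h => ?_⟩
  rcases h with h | h
  · exact not_extensionEstimateS6_of_lt_five hq h
  · exact not_extensionEstimateS6_of_one_lt hp hq h
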